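/- Let $G$ be a locally compact Hausdorff group with a compact symmetric generating set $S$ (that is, $\bigcup_{n\ge 0}S^n=G$), and let $H\le G$ be a closed subgroup with a compact symmetric generating set $T$. Equip them with left Haar measures $\mu_G,\mu_H$ and with the word metrics $d_S(g,g')=\min\{n: g^{-1}g'\in S^n\}$ and $d_T$. Let $1\le p\le\infty$. For $A\subseteq G$ put $$J_{G,p}(A)=\sup_{f}\frac{\|f\|_p}{\big\|\sup_{s\in S}|\varrho(s)f-f|\,\big\|_p},\qquad \varrho(s)f(x)=f(xs),$$ the supremum being over the functions $f\in L^p(G)$ supported in $A$ (with $0/0=0$ and $a/0=\infty$ for $a>0$), and define the right-profiles $$j_{G,p}(v)=\sup_{\mu_G(A)\le v}J_{G,p}(A),\qquad J^b_{G,p}(r)=J_{G,p}(B_S(1,r)),$$ where $A$ ranges over measurable sets and $B_S(1,r)$ is the closed ball; define $j_{H,p}$ and $J^b_{H,p}$ in the same way from $T$ and $\mu_H$. Write $f\preceq g$ if there is $C>0$ with $f(t)=O(g(Ct))$ as $t\to\infty$. Let $\rho(t)=\inf\{d_S(h,h'): h,h'\in H,\ d_T(h,h')\ge t\}$ be the compression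 of $H\hookrightarrow G$ (with $\inf\emptyset=\infty$) and $\rho^{-1}(r)=\sup\{t\ge 0:\rho(t)\le r\}$ its generalized inverse. Call $H$ undistorted if there is $C$ with $d_T(h,h')\le C\,d_S(h,h')+C$ for all $h,h'\in H$. Assume that $G/H$ carries a nonzero $G$-invariant Radon measure, or that $G$ and $H$ are both unimodular. Then: 1. $j_{G,p}\preceq j_{H,p}$. 2. $J^b_{G,p}\preceq J^b_{H,p}\circ\rho^{-1}$; moreover there is $c>0$ such that $J^b_{G,p}(c\,\rho(\cdot))\preceq J^b_{H,p}$. 3. If $H$ is undistorted in $G$, then $J^b_{G,p}\preceq J^b_{H,p}$. The same conclusions 1–3 hold if the denominator $\|\sup_{s}|\varrho(s)f-f|\|_p$ is replaced, for both groups, by $\sup_{s}\|\varrho(s)f-f\|_p$. If $G$ and $H$ are both unimodular, then conclusions 1 and 3 also hold for the left-profiles, in which the denominator is $\sup_{s}\|\lambda(s)f-f\|_p$ with $\lambda(s)f(x)=f(s^{-1}x)$. -/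

import Mathlib

open MeasureTheory Filter Set
open scoped ENNReal NNReal Pointwise

noncomputable section

/-- `S` is a compact symmetric subset of `G` with `⋃ n, S ^ n = G`. -/
structure IsCompactSymmGen {G : Type*} [Group G] [TopologicalSpace G] (S : Set G) : Prop where
  isCompact : IsCompact S
  symm : S⁻¹ = S
  iUnion_pow : ⋃ n : ℕ, S ^ n = univ

/-- The left-invariant word metric `d_S (g, h) = inf {n | g⁻¹ h ∈ S ^ n}`. -/
def wordDist {G : Type*} [Group G] (S : Set G) (g h : G) : ℕ :=
  sInf {n : ℕ | g⁻¹ * h ∈ S ^ n}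

/-- The closed ball `B(1, r)` of the word metric. -/
def wordBall {G : Type*} [Group G] (S : Set G) (r : ℝ≥0∞) : Set G :=
  {g | (wordDist S 1 g : ℝ≥0∞) ≤ r}

/-- `‖sup_{s ∈ S} |f - ρ(s) f|‖_p`, the `L^p`-norm of the gradient of `f` at scale `1` for the word
metric; here `ρ(s) f (x) = f (x s)`. -/
def rightGradNorm {G : Type*} [Group G] [MeasurableSpace G] (S : Set G) (μ : Measure G)
    (p : ℝ≥0∞) (f : G → ℝ) : ℝ≥0∞ :=
  eLpNorm (fun x => ⨆ s ∈ S, ‖f (x * s) - f x‖ₑ) p μ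

/-- `sup_{s ∈ S} ‖f - ρ(s) f‖_p`, with `ρ(s) f (x) = f (x s)`. -/
def rightTransNorm {G : Type*} [Group G] [MeasurableSpace G] (S : Set G) (μ : Measure G)
    (p : ℝ≥0∞) (f : G → ℝ) : ℝ≥0∞ :=
  ⨆ s ∈ S, eLpNorm (fun x => f (x * s) - f x) p μ

/-- `sup_{s ∈ S} ‖f - λ(s) f‖_p`, with `λ(s) f (x) = f (s⁻¹ x)`. -/
def leftTransNorm {G : Type*} [Group G] [MeasurableSpace G] (S : Set G) (μ : Measure G)
    (p : ℝ≥0∞) (f : G → ℝ) : ℝ≥0∞ :=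
  ⨆ s ∈ S, eLpNorm (fun x => f (s⁻¹ * x) - f x) p μ

/-- `J_p(A)`: the supremum of `‖f‖_p / N f` over the `f` in `L^p` that are supported in `A`,
where `N f` is one of the three quantities above. It is infinite as soon as some such `f` has
`‖f‖_p ≠ 0` and `N f = 0`, while a quotient `0 / 0` counts as `0`. -/
def isoRatio {G : Type*} [MeasurableSpace G] (μ : Measure G) (p : ℝ≥0∞)
    (N : (G → ℝ) → ℝ≥0∞) (A : Set G) : ℝ≥0∞ :=
  ⨆ (f : G → ℝ) (_ : MemLp f p μ) (_ : Function.support f ⊆ A), eLpNorm f p μ / N f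

/-- The `L^p`-isoperimetric profile `j(v) = sup_{μ(A) ≤ v} J_p(A)`. -/
def isoProfile {G : Type*} [MeasurableSpace G] (μ : Measure G) (p : ℝ≥0∞)
    (N : (G → ℝ) → ℝ≥0∞) (v : ℝ≥0∞) : ℝ≥0∞ :=
  ⨆ (A : Set G) (_ : MeasurableSet A) (_ : μ A ≤ v), isoRatio μ p N A

/-- The `L^p`-isoperimetric profile inside balls `J^b(r) = J_p(B(1, r))`. -/
def ballProfile {G : Type*} [Group G] [MeasurableSpace G] (S : Set G) (μ : Measure G)
    (p : ℝ≥0∞) (N : (G → ℝ) → ℝ≥0∞) (r : ℝ≥0∞) : ℝ≥0∞ :=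
  isoRatio μ p N (wordBall S r)

/-- `f ⪯ g`: there is `C > 0` such that `f (t) = O(g (C t))` as `t → ∞`, `t` real. -/
def AsympLE (f g : ℝ≥0∞ → ℝ≥0∞) : Prop :=
  ∃ C : ℝ≥0, 0 < C ∧ ∃ K : ℝ≥0, ∀ᶠ t : ℝ≥0 in atTop, f t ≤ K * g (C * t)

/-- The compression `ρ(t) = inf {d_S (h, h') | d_T (h, h') ≥ t}` of the inclusion of `H` in `G`
(with `inf ∅ = ∞`). -/
def compression {G : Type*} [Group G] (S : Set G) (H : Subgroup G) (T : Set H) (t : ℝ≥0∞) :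
    ℝ≥0∞ :=
  ⨅ (h : H) (h' : H) (_ : t ≤ (wordDist T h h' : ℝ≥0∞)), (wordDist S (h : G) (h' : G) : ℝ≥0∞)

/-- The generalized inverse `ρ⁻¹(r) = sup {t | ρ(t) ≤ r}` of a function `ρ`. -/
def genInverse (ρ : ℝ≥0∞ → ℝ≥0∞) (r : ℝ≥0∞) : ℝ≥0∞ :=
  sSup {t | ρ t ≤ r}

/-- `H` is undistorted in `G`: the inclusion is a quasi-isometric embedding for the word metrics
(the inequality `d_S ≤ C d_T + C` is automatic). -/
def Undistorted {G : Type*} [Group G] (S : Set G) (H : Subgroup G) (T : Set H) : Prop :=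
  ∃ C : ℕ, ∀ h h' : H, wordDist T h h' ≤ C * wordDist S (h : G) (h' : G) + C

/-- `G/H` carries a nonzero `G`-invariant Radon measure. -/
def CarriesInvariantMeasure {G : Type*} [Group G] [TopologicalSpace G] (H : Subgroup G) : Prop :=
  letI : MeasurableSpace (G ⧸ H) := borel (G ⧸ H)
  ∃ m : Measure (G ⧸ H), m.Regular ∧ m ≠ 0 ∧ ∀ g : G, m.map (fun x => g • x) = m

end

/-! A function f on G is regularized at a fixed scale and then restricted to a coset of H. For a
compact neighborhood U of 1, let F(x) be the integral of |f| over xU minus a multiple of the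
oscillation of f over xU, cut off at 0 (`trimmedAvg`). Three pointwise facts carry the proof. F(xt)
and F(x) differ by at most a multiple of the oscillation Γ(x) of f over xV, where V contains U and
TU; the bound does not depend on t ∈ T, so it survives a supremum taken inside the norm. |f| is
recovered from F up to oscillation terms. Finally, F(x) ≠ 0 forces f ≠ 0 on at least half of xU;
this is the purpose of the subtraction, and it bounds the size of the support of F on every coset by
that of f (`measure_fiber_le`). Minkowski's inequality bounds ‖Γ‖_p by a multiple of N(f) = sup_s
‖ρ(s)f − f‖_p.

Either hypothesis on G and H makes the modular function of G restrict to that of H, which yields a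
Weil formula decomposing Haar measure along the cosets (`exists_weil_measure`). Hence on some coset
the ratio of the norms of Γ and F is at most twice the global one (`exists_fiber_eLpNorm_le`). The
outcome is `exists_fiber_function`: either ‖f‖ ≤ K N(f), which is harmless because the profile of H
is eventually bounded below by a positive constant, or a function on H has a comparable ratio. Its
support has controlled measure, which gives conclusion 1, and lies near the support of f, which
after a translation in H gives 2 and 3. The estimate runs from the smaller denominator on G to the
larger one on H, so it covers both right-profiles. Inversion turns the left-profiles of unimodular
groups into right ones.

G is σ-compact but need not be second countable, so (x, u) ↦ f(xu) may fail to be measurable for the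
product σ-algebra when f is only Borel. Therefore f is first replaced by a Baire function equal to
it almost everywhere. -/

/-! ### Baire functions and measurability on products -/

/-- The Baire `σ`-algebra: the one generated by the continuous real functions. -/
@[reducible] def baireAlgebra (X : Type*) [TopologicalSpace X] : MeasurableSpace X :=
  ⨆ k : C(X, ℝ), MeasurableSpace.comap k (borel ℝ)

/-- The `σ`-algebra on `X` makes all continuous real functions measurable. -/
class ContMeas (X : Type*) [TopologicalSpace X] [MeasurableSpace X] : Prop where
  measurable : ∀ k : C(X, ℝ), Measurable k

instance (priority := 100) ContMeas.of_opensMeasurableSpace {X : Type*} [TopologicalSpace X]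
    [MeasurableSpace X] [OpensMeasurableSpace X] : ContMeas X :=
  ⟨fun k => k.continuous.measurable⟩

theorem ContMeas.baireAlgebra (X : Type*) [TopologicalSpace X] :
    @ContMeas X _ (baireAlgebra X) := by
  let := _root_.baireAlgebra X
  refine ⟨fun k => ?_⟩
  rw [measurable_iff_comap_le]
  exact le_iSup (fun k : C(X, ℝ) => MeasurableSpace.comap k (borel ℝ)) k

/-- Real or extended nonnegative functions that are measurable for the Baire `σ`-algebra. -/
def BaireMeas {X β : Type*} [TopologicalSpace X] [MeasurableSpace β] (f : X → β) : Prop :=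
  @Measurable X β (baireAlgebra X) _ f

/-- The gain over Borel functions is that Z may carry a σ-algebra smaller than the Borel one, such
as a product of Borel σ-algebras. -/
theorem BaireMeas.comp_continuous {X Z β : Type*} [TopologicalSpace X] [TopologicalSpace Z]
    [MeasurableSpace Z] [ContMeas Z] [MeasurableSpace β] {f : X → β} (hf : BaireMeas f) {Φ : Z → X}
    (hΦ : Continuous Φ) : Measurable fun z => f (Φ z) := by
  have h : @Measurable Z X _ (baireAlgebra X) Φ := by
    rw [measurable_iff_comap_le, baireAlgebra, MeasurableSpace.comap_iSup]
    refine iSup_le fun k => ?_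
    rw [MeasurableSpace.comap_comp, ← measurable_iff_comap_le]
    exact ContMeas.measurable (k.comp ⟨Φ, hΦ⟩)
  exact @Measurable.comp Z X β _ (baireAlgebra X) _ f Φ hf h

theorem BaireMeas.measurable {X β : Type*} [TopologicalSpace X] [MeasurableSpace X] [ContMeas X]
    [MeasurableSpace β] {f : X → β} (hf : BaireMeas f) : Measurable f :=
  hf.comp_continuous continuous_id

theorem Continuous.baireMeas {X : Type*} [TopologicalSpace X] {f : X → ℝ} (hf : Continuous f) :
    BaireMeas f :=
  (ContMeas.baireAlgebra X).measurable ⟨f, hf⟩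

/-- Over a compact piece of Y, currying turns k into a continuous map from X to a metric space of
continuous functions. Its range is separable because X is σ-compact, so a countable dense subset of
the range writes each set {k > c} as a countable union of measurable rectangles. -/
theorem measurable_of_continuous_prod {X Y : Type*} [TopologicalSpace X] [SigmaCompactSpace X]
    [MeasurableSpace X] [ContMeas X] [TopologicalSpace Y] [SigmaCompactSpace Y]
    [LocallyCompactSpace Y] [RegularSpace Y] [MeasurableSpace Y] [ContMeas Y] (k : C(X × Y, ℝ)) :
    Measurable k := by
  classical
  let E : CompactExhaustion Y := default
  -- The compact sets E n need not be measurable here. The sets {χ n > 0} are, and they lie between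
  -- E n and E (n + 1).
  have hχ : ∀ n, ∃ χ : C(Y, ℝ), EqOn χ 1 (E n) ∧ EqOn χ 0 (interior (E (n + 1)))ᶜ := fun n => by
    obtain ⟨χ, h1, h0, -, -⟩ := exists_continuous_one_zero_of_isCompact (E.isCompact n)
      (isOpen_interior (s := E (n + 1))).isClosed_compl
      (disjoint_compl_right_iff_subset.2 (E.subset_interior_succ n))
    exact ⟨χ, h1, h0⟩
  choose χ hχ1 hχ0 using hχ
  let ι : ∀ n, C(E (n + 1), Y) := fun n => ⟨Subtype.val, continuous_subtype_val⟩
  have : ∀ n, CompactSpace (E (n + 1)) := fun n => isCompact_iff_compactSpace.1 (E.isCompact _)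
  let κ : ∀ n, C(X, C(E (n + 1), ℝ)) := fun n =>
    ContinuousMap.curry (k.comp ((ContinuousMap.id X).prodMap (ι n)))
  have hsep : ∀ n, TopologicalSpace.IsSeparable (range (κ n)) := fun n => by
    rw [← image_univ, ← iUnion_compactCovering, image_iUnion]
    exact .iUnion fun j => ((isCompact_compactCovering X j).image (κ n).continuous).isSeparable
  choose t hts htc htd using fun n => (hsep n).exists_countable_dense_subset
  choose d hd using fun n (g : t n) => hts n g.2
  have key : ∀ c : ℝ, k ⁻¹' Ioi c = ⋃ n, ⋃ g : t n, ⋃ m : ℕ,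
      {x | dist (κ n x) g < 1 / (m + 1 : ℝ)} ×ˢ
        ({y | c + 1 / (m + 1 : ℝ) < k (d n g, y)} ∩ {y | 0 < χ n y}) := by
    intro c
    have hclose : ∀ n (g : t n) x (y : Y) (hy : y ∈ E (n + 1)),
        |k (x, y) - k (d n g, y)| ≤ dist (κ n x) g := fun n g x y hy => by
      rw [← hd n g, ← Real.dist_eq]
      exact ContinuousMap.dist_apply_le_dist (f := κ n x) (g := κ n (d n g)) ⟨y, hy⟩
    ext ⟨x, y⟩
    simp only [mem_preimage, mem_Ioi, mem_iUnion, mem_prod, mem_inter_iff, mem_ofPred_eq]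
    constructor
    · intro h
      obtain ⟨n, hn⟩ := mem_iUnion.1 (E.iUnion_eq ▸ mem_univ y : y ∈ ⋃ n, E n)
      obtain ⟨m, hm⟩ := exists_nat_one_div_lt (show 0 < (k (x, y) - c) / 2 by linarith)
      have hx : κ n x ∈ closure (t n) := htd n (mem_range_self x)
      obtain ⟨g, hg, hxg⟩ := Metric.mem_closure_iff.1 hx (1 / (m + 1 : ℝ)) (by positivity)
      refine ⟨n, ⟨g, hg⟩, m, hxg, ?_, ?_⟩
      · have := hclose n ⟨g, hg⟩ x y (E.subset_succ n hn)
        have := (abs_le.1 this).2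
        simp only at this
        linarith
      · rw [hχ1 n hn]; simp
    · rintro ⟨n, g, m, hxg, hc, hpos⟩
      have hy : y ∈ E (n + 1) := by
        by_contra hy
        have : χ n y = 0 := hχ0 n fun h => hy (interior_subset h)
        exact hpos.ne' this
      have := (abs_le.1 (hclose n g x y hy)).1
      linarith
  refine measurable_of_Ioi fun c => ?_
  rw [key c]
  refine .iUnion fun n => ?_
  have := (htc n).to_subtype
  refine .iUnion fun g => .iUnion fun m => ?_
  refine MeasurableSet.prod ?_ (MeasurableSet.inter ?_ ?_)
  · exact (ContMeas.measurable ⟨fun x => dist (κ n x) g,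
      (κ n).continuous.dist continuous_const⟩) measurableSet_Iio
  · exact (ContMeas.measurable ⟨fun y => k (d n g, y), by fun_prop⟩) measurableSet_Ioi
  · exact (ContMeas.measurable (χ n)) measurableSet_Ioi

instance ContMeas.prod {X Y : Type*} [TopologicalSpace X] [SigmaCompactSpace X]
    [MeasurableSpace X] [ContMeas X] [TopologicalSpace Y] [SigmaCompactSpace Y]
    [LocallyCompactSpace Y] [RegularSpace Y] [MeasurableSpace Y] [ContMeas Y] :
    ContMeas (X × Y) :=
  ⟨measurable_of_continuous_prod⟩

/-- X itself is given its Baire σ-algebra in Tonelli's theorem, so partial integrals stay Baire and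
can again be composed with continuous maps. -/
theorem BaireMeas.lintegral_right {X Y : Type*} [TopologicalSpace X] [SigmaCompactSpace X]
    [TopologicalSpace Y] [SigmaCompactSpace Y] [LocallyCompactSpace Y] [RegularSpace Y]
    [MeasurableSpace Y] [ContMeas Y] {κ : Measure Y} [SFinite κ] {F : X × Y → ℝ≥0∞}
    (hF : BaireMeas F) : BaireMeas fun x => ∫⁻ y, F (x, y) ∂κ := by
  let := baireAlgebra X
  have := ContMeas.baireAlgebra X
  exact Measurable.lintegral_prod_right' (hF.comp_continuous continuous_id)

theorem BaireMeas.comp {X Z β : Type*} [TopologicalSpace X] [TopologicalSpace Z]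
    [MeasurableSpace β] {f : X → β} (hf : BaireMeas f) {Φ : Z → X}
    (hΦ : Continuous Φ) : BaireMeas fun z => f (Φ z) := by
  let := baireAlgebra Z
  have := ContMeas.baireAlgebra Z
  exact hf.comp_continuous hΦ

/-- An `L^p` function with `p < ∞` agrees almost everywhere with a Baire function. -/
theorem MeasureTheory.MemLp.exists_baireMeas_of_ne_top {X : Type*} [TopologicalSpace X]
    [NormalSpace X]
    [R1Space X] [WeaklyLocallyCompactSpace X] [MeasurableSpace X] [BorelSpace X] {μ : Measure X}
    [μ.Regular] {p : ℝ≥0∞} (hp0 : p ≠ 0) (hp : p ≠ ∞) {f : X → ℝ} (hf : MemLp f p μ) :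
    ∃ g : X → ℝ, BaireMeas g ∧ f =ᵐ[μ] g := by
  obtain ⟨u, -, hu0, hu⟩ := exists_seq_strictAnti_tendsto' (α := ℝ≥0∞) zero_lt_one
  choose g hgs hgn hgc hgm using fun n : ℕ =>
    hf.exists_hasCompactSupport_eLpNorm_sub_le hp (hu0 n).1.ne'
  have hT : Tendsto (fun n => eLpNorm (g n - f) p μ) atTop (nhds 0) := by
    refine tendsto_of_tendsto_of_tendsto_of_le_of_le tendsto_const_nhds hu (fun _ => zero_le)
      fun n => ?_
    rw [eLpNorm_sub_comm]
    exact hgn n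
  obtain ⟨ns, -, hns⟩ := (tendstoInMeasure_of_tendsto_eLpNorm hp0
    (fun n => (hgm n).1) hf.1 hT).exists_seq_tendsto_ae
  refine ⟨fun x => limsup (fun i => g (ns i) x) atTop, ?_, ?_⟩
  · exact Measurable.limsup fun i => (hgc (ns i)).baireMeas
  · filter_upwards [hns] with x hx using hx.limsup_eq.symm

theorem MeasureTheory.MemLp.exists_baireMeas {X : Type*} [TopologicalSpace X]
    [T2Space X] [NormalSpace X] [SigmaCompactSpace X]
    [LocallyCompactSpace X] [MeasurableSpace X] [BorelSpace X] {μ : Measure X}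
    [μ.Regular] {p : ℝ≥0∞} (hp : 1 ≤ p) {f : X → ℝ} (hf : MemLp f p μ) :
    ∃ g : X → ℝ, BaireMeas g ∧ f =ᵐ[μ] g := by
  -- On a compact set f is in L¹ for every p ≥ 1, including p = ∞. The pieces glue by a limsup,
  -- since at almost every point they eventually equal f.
  have h : ∀ n, ∃ g : X → ℝ, BaireMeas g ∧ (compactCovering X n).indicator f =ᵐ[μ] g := fun n => by
    refine MemLp.exists_baireMeas_of_ne_top one_ne_zero ENNReal.one_ne_top ?_
    rw [memLp_indicator_iff_restrict (isCompact_compactCovering X n).measurableSet]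
    have : IsFiniteMeasure (μ.restrict (compactCovering X n)) :=
      isFiniteMeasure_restrict.2 (isCompact_compactCovering X n).measure_lt_top.ne
    exact (hf.restrict _).mono_exponent hp
  choose g hg hfg using h
  refine ⟨fun x => limsup (fun i => g i x) atTop, Measurable.limsup hg, ?_⟩
  filter_upwards [ae_all_iff.2 hfg] with x hx
  obtain ⟨n, hn⟩ := exists_mem_compactCovering x
  refine (Tendsto.limsup_eq (tendsto_const_nhds.congr' ?_)).symm
  filter_upwards [eventually_ge_atTop n] with m hm
  rw [← hx m, indicator_of_mem (compactCovering_subset X hm hn)]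

/-! ### Minkowski's integral inequality -/

/-- For p < ∞, Hölder against the constant 1 on the finite measure κ, followed by Tonelli; for p =
∞, an exchange of almost-everywhere quantifiers. -/
theorem eLpNorm_lintegral_le {X Y : Type*} [MeasurableSpace X] [MeasurableSpace Y] {μ : Measure X}
    [SFinite μ] {κ : Measure Y} [IsFiniteMeasure κ] {p : ℝ≥0∞} (hp : 1 ≤ p) {k : X × Y → ℝ≥0∞}
    (hk : Measurable k) {L : ℝ≥0∞} (hL : ∀ᵐ y ∂κ, eLpNorm (fun x => k (x, y)) p μ ≤ L) :
    eLpNorm (fun x => ∫⁻ y, k (x, y) ∂κ) p μ ≤ κ univ * L := by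
  rcases eq_or_ne p ∞ with rfl | hpt
  · simp only [eLpNorm_exponent_top, eLpNormEssSup] at hL ⊢
    have h1 : ∀ᵐ y ∂κ, ∀ᵐ x ∂μ, k (x, y) ≤ L := by
      filter_upwards [hL] with y hy
      filter_upwards [ae_le_essSup (f := fun x => ‖k (x, y)‖ₑ) (μ := μ)] with x hx
      exact (by simpa using hx : k (x, y) ≤ _).trans (by simpa using hy)
    have h2 : ∀ᵐ x ∂μ, ∀ᵐ y ∂κ, k (x, y) ≤ L :=
      (Measure.ae_ae_comm (μ := μ) (ν := κ) (p := fun x y => k (x, y) ≤ L)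
        (hk measurableSet_Iic)).2 h1
    refine essSup_le_of_ae_le _ ?_
    filter_upwards [h2] with x hx
    calc ‖∫⁻ y, k (x, y) ∂κ‖ₑ = ∫⁻ y, k (x, y) ∂κ := by simp
      _ ≤ ∫⁻ _, L ∂κ := lintegral_mono_ae hx
      _ = κ univ * L := by rw [lintegral_const, mul_comm]
  · have hp0 : p ≠ 0 := (zero_lt_one.trans_le hp).ne'
    have hr : 1 ≤ p.toReal := by simpa using ENNReal.toReal_mono hpt hp
    have hr0 : 0 < p.toReal := zero_lt_one.trans_le hr
    have hmeas : ∀ x, Measurable fun y => k (x, y) := fun x => hk.comp (by fun_prop)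
    have hpt1 : ∀ x, (∫⁻ y, k (x, y) ∂κ) ^ p.toReal
        ≤ (∫⁻ y, k (x, y) ^ p.toReal ∂κ) * κ univ ^ (p.toReal - 1) := fun x => by
      have h := eLpNorm_le_eLpNorm_mul_rpow_measure_univ (μ := κ) hp
        (hmeas x).aestronglyMeasurable
      rw [eLpNorm_one_eq_lintegral_enorm, eLpNorm_eq_lintegral_rpow_enorm_toReal hp0 hpt] at h
      simp only [enorm_eq_self] at h
      have h' := ENNReal.rpow_le_rpow h hr0.le
      rw [ENNReal.mul_rpow_of_nonneg _ _ hr0.le, ← ENNReal.rpow_mul, ← ENNReal.rpow_mul,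
        one_div_mul_cancel hr0.ne', ENNReal.rpow_one] at h'
      convert h' using 3
      simp only [ENNReal.toReal_one]
      field_simp
    rw [eLpNorm_eq_lintegral_rpow_enorm_toReal hp0 hpt, one_div,
      ENNReal.rpow_inv_le_iff hr0]
    simp only [enorm_eq_self]
    calc ∫⁻ x, (∫⁻ y, k (x, y) ∂κ) ^ p.toReal ∂μ
        ≤ ∫⁻ x, (∫⁻ y, k (x, y) ^ p.toReal ∂κ) * κ univ ^ (p.toReal - 1) ∂μ :=
          lintegral_mono hpt1
      _ = (∫⁻ x, ∫⁻ y, k (x, y) ^ p.toReal ∂κ ∂μ) * κ univ ^ (p.toReal - 1) :=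
          lintegral_mul_const _ (hk.pow_const _).lintegral_prod_right'
      _ = (∫⁻ y, ∫⁻ x, k (x, y) ^ p.toReal ∂μ ∂κ) * κ univ ^ (p.toReal - 1) := by
          rw [lintegral_lintegral_swap (f := fun x y => k (x, y) ^ p.toReal)
            (hk.pow_const _).aemeasurable]
      _ ≤ (∫⁻ _, L ^ p.toReal ∂κ) * κ univ ^ (p.toReal - 1) := by
          gcongr ?_ * _
          refine lintegral_mono_ae ?_
          filter_upwards [hL] with y hy
          rw [eLpNorm_eq_lintegral_rpow_enorm_toReal hp0 hpt, one_div,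
            ENNReal.rpow_inv_le_iff hr0] at hy
          simpa using hy
      _ = (κ univ * L) ^ p.toReal := by
          have h := ENNReal.rpow_add_of_nonneg (x := κ univ) 1 (p.toReal - 1) zero_le_one
            (by linarith)
          rw [add_sub_cancel, ENNReal.rpow_one] at h
          rw [lintegral_const, ENNReal.mul_rpow_of_nonneg _ _ hr0.le, h]
          ring

/-! ### The modular function and right translations -/

section Modular

variable {G : Type*} [Group G] [TopologicalSpace G] [IsTopologicalGroup G] [LocallyCompactSpace G]
  [MeasurableSpace G] [BorelSpace G] (μ : Measure G) [μ.IsHaarMeasure]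

open Measure

omit [IsTopologicalGroup G] [LocallyCompactSpace G] in
theorem continuous_integral_comp_mul {G' : Type*} [TopologicalSpace G'] [LocallyCompactSpace G']
    [Group G'] [IsTopologicalGroup G'] {ν : Measure G} [IsFiniteMeasureOnCompacts ν]
    {j : G →* G'} (hj : Topology.IsClosedEmbedding j) {f : G' → ℝ} (hf : Continuous f)
    (hfs : HasCompactSupport f) : Continuous fun x => ∫ h, f (x * j h) ∂ν := by
  refine continuous_iff_continuousAt.2 fun x₀ => ?_
  obtain ⟨N, hN, hx⟩ := exists_compact_mem_nhds x₀
  refine ContinuousOn.continuousAt (s := N) ?_ hx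
  refine continuousOn_integral_of_compact_support (k := j ⁻¹' (N⁻¹ * tsupport f))
    (hj.isCompact_preimage (hN.inv.mul hfs)) ?_ ?_
  · exact (hf.comp (continuous_fst.mul (hj.continuous.comp continuous_snd))).continuousOn
  · intro x h hxN hh
    by_contra hne
    refine hh ?_
    refine mem_preimage.2 (mem_mul.2 ⟨x⁻¹, Set.inv_mem_inv.2 hxN, x * j h,
      subset_tsupport _ hne, by group⟩)

theorem map_mul_right_eq_smul [μ.Regular] (g : G) :
    map (· * g) μ = modularCharacterFun g • μ := by
  rw [modularCharacterFun_eq_haarScalarFactor μ g]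
  have : (map (· * g) μ).Regular := Regular.map (Homeomorph.mulRight g)
  exact isMulLeftInvariant_eq_smul_of_regular _ μ

theorem lintegral_mul_right_eq [μ.Regular] (f : G → ℝ≥0∞) (g : G) :
    ∫⁻ x, f (x * g) ∂μ = modularCharacterFun g * ∫⁻ x, f x ∂μ := by
  have h := lintegral_map_equiv (μ := μ) f (Homeomorph.mulRight g).toMeasurableEquiv
  have h2 : map (Homeomorph.mulRight g).toMeasurableEquiv μ = modularCharacterFun g • μ :=
    map_mul_right_eq_smul μ g
  rw [h2, lintegral_smul_measure] at h
  exact h.symm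

theorem integral_mul_right_eq [μ.Regular] (f : G → ℝ) (g : G) :
    ∫ x, f (x * g) ∂μ = modularCharacterFun g * ∫ x, f x ∂μ := by
  have h := integral_map_equiv (μ := μ) (Homeomorph.mulRight g).toMeasurableEquiv f
  have h2 : map (Homeomorph.mulRight g).toMeasurableEquiv μ = modularCharacterFun g • μ :=
    map_mul_right_eq_smul μ g
  rw [h2, integral_smul_nnreal_measure] at h
  exact h.symm

theorem modularCharacterFun_eq_one [μ.IsMulRightInvariant] (g : G) :
    modularCharacterFun g = 1 := by
  rw [modularCharacterFun_eq_haarScalarFactor μ g]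
  simp only [map_mul_right_eq_self, haarScalarFactor_self]

include μ in
theorem continuous_modularCharacterFun [μ.Regular] :
    Continuous (modularCharacterFun : G → ℝ≥0) := by
  obtain ⟨⟨f, hf⟩, hfs, hf0, hf1⟩ : ∃ f : C(G, ℝ), HasCompactSupport f ∧ 0 ≤ f ∧ f 1 ≠ 0 :=
    exists_continuous_nonneg_pos 1
  have hpos : 0 < ∫ x, f x ∂μ := hf.integral_pos_of_hasCompactSupport_nonneg_nonzero hfs hf0 hf1
  have hμ : ∀ g, (modularCharacterFun g : ℝ) = (∫ x, f (x * g) ∂μ) / ∫ x, f x ∂μ := fun g => by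
    rw [integral_mul_right_eq, mul_div_cancel_right₀ _ hpos.ne']
  refine continuous_induced_rng.2 ?_
  have hc : Continuous fun g => ∫ x, f (x * g) ∂μ := by
    refine continuous_iff_continuousAt.2 fun g₀ => ?_
    obtain ⟨N, hN, hx⟩ := exists_compact_mem_nhds g₀
    refine ContinuousOn.continuousAt (s := N) ?_ hx
    refine continuousOn_integral_of_compact_support (k := tsupport f * N⁻¹)
      (IsCompact.mul hfs hN.inv) ?_ ?_
    · exact (hf.comp (continuous_snd.mul continuous_fst)).continuousOn
    · intro x h hxN hh
      by_contra hne
      exact hh (mem_mul.2 ⟨h * x, subset_tsupport _ hne, x⁻¹, Set.inv_mem_inv.2 hxN, by group⟩)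
  exact (hc.div_const _).congr fun g => (hμ g).symm

/-- The exact factor is Δ(g)^(1/p); since 0 ≤ 1/p ≤ 1 it is at most max(1, Δ(g)), which is bounded
on compact sets independently of p. -/
theorem eLpNorm_comp_mul_right_le [μ.Regular] {p : ℝ≥0∞} (hp : 1 ≤ p) (f : G → ℝ) (g : G) :
    eLpNorm (fun x => f (x * g)) p μ
      ≤ (max 1 (modularCharacterFun g) : ℝ≥0) * eLpNorm f p μ := by
  have h := (Homeomorph.mulRight g).toMeasurableEquiv.measurableEmbedding.eLpNorm_map_measure
    (μ := μ) (p := p) (g := f)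
  have h2 : map (Homeomorph.mulRight g).toMeasurableEquiv μ = modularCharacterFun g • μ :=
    map_mul_right_eq_smul μ g
  rw [h2] at h
  have h3 : eLpNorm (fun x => f (x * g)) p μ = eLpNorm f p ((modularCharacterFun g : ℝ≥0∞) • μ) :=
    h.symm
  rw [h3]
  refine (eLpNorm_smul_measure_le _ _ _ _).trans ?_
  rw [smul_eq_mul]
  gcongr
  have hq0 : 0 ≤ (1 / p).toReal := ENNReal.toReal_nonneg
  have hq1 : (1 / p).toReal ≤ 1 := by
    have : 1 / p ≤ 1 := by rw [one_div]; exact ENNReal.inv_le_one.2 hp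
    simpa using ENNReal.toReal_mono ENNReal.one_ne_top this
  rw [ENNReal.coe_max]
  calc (modularCharacterFun g : ℝ≥0∞) ^ (1 / p).toReal
      ≤ (max 1 (modularCharacterFun g) : ℝ≥0∞) ^ (1 / p).toReal := by gcongr; simp
    _ ≤ (max 1 (modularCharacterFun g) : ℝ≥0∞) ^ (1 : ℝ) :=
        ENNReal.rpow_le_rpow_of_exponent_le (le_max_left _ _) hq1
    _ = _ := by simp

theorem ae_comp_mul_right [μ.Regular] {q : G → Prop} (h : ∀ᵐ x ∂μ, q x) (g : G) :
    ∀ᵐ x ∂μ, q (x * g) := by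
  have h2 : ∀ᵐ x ∂(map (· * g) μ), q x := by
    rw [map_mul_right_eq_smul]; exact Measure.ae_smul_measure h _
  exact ae_of_ae_map (measurable_mul_const g).aemeasurable h2

theorem rightTransNorm_congr_ae [μ.Regular] {S : Set G} {p : ℝ≥0∞} {f f' : G → ℝ}
    (h : f =ᵐ[μ] f') : rightTransNorm S μ p f = rightTransNorm S μ p f' := by
  refine iSup_congr fun s => iSup_congr fun _ => eLpNorm_congr_ae ?_
  filter_upwards [h, ae_comp_mul_right μ h s] with x h1 h2
  rw [h1, h2]

/-- Translation by a word of bounded length is controlled by the translation norm. -/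
theorem exists_eLpNorm_translate_sub_le [μ.Regular] {S : Set G} (hS : IsCompact S) {p : ℝ≥0∞}
    (hp : 1 ≤ p) (n : ℕ) : ∃ c : ℝ≥0, ∀ f : G → ℝ, Measurable f → ∀ u ∈ S ^ n,
      eLpNorm (fun x => f (x * u) - f x) p μ ≤ c * rightTransNorm S μ p f := by
  obtain ⟨M, hM⟩ : ∃ M : ℝ≥0, ∀ s ∈ S, max 1 (modularCharacterFun s) ≤ M := by
    obtain ⟨M, hM⟩ := (hS.image (continuous_const.max
      (continuous_modularCharacterFun μ) : Continuous fun s : G =>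
        max (1 : ℝ≥0) (modularCharacterFun s))).bddAbove
    exact ⟨M, fun s hs => hM (mem_image_of_mem _ hs)⟩
  induction n with
  | zero =>
    refine ⟨0, fun f _ u hu => ?_⟩
    rw [pow_zero, Set.mem_one] at hu
    subst hu
    simp
  | succ n ih =>
    obtain ⟨c, hc⟩ := ih
    refine ⟨M * c + 1, fun f hf u hu => ?_⟩
    rw [pow_succ'] at hu
    obtain ⟨s, hs, v, hv, rfl⟩ := mem_mul.1 hu
    -- Telescoping along the word: the first term is a right translate by s, which costs the factor
    -- M.
    have h1 : (fun x => f (x * (s * v)) - f x) =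
        (fun x => (fun y => f (y * v) - f y) (x * s)) + fun x => f (x * s) - f x := by
      ext x; simp [mul_assoc]
    have hm : ∀ a : G, Measurable fun x => f (x * a) := fun a => hf.comp (measurable_mul_const a)
    rw [h1]
    refine (eLpNorm_add_le ?_ ?_ hp).trans ?_
    · exact (((hm v).sub hf).comp (measurable_mul_const s)).aestronglyMeasurable
    · exact ((hm s).sub hf).aestronglyMeasurable
    · push_cast
      rw [add_mul, one_mul, mul_assoc]
      refine add_le_add ?_ ?_
      · refine (eLpNorm_comp_mul_right_le μ hp (fun y => f (y * v) - f y) s).trans ?_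
        exact mul_le_mul' (by exact_mod_cast hM s hs) (hc f hf v hv)
      · exact le_iSup₂ (f := fun s _ => eLpNorm (fun x => f (x * s) - f x) p μ) s hs

end Modular

/-! ### Compact generating sets -/

namespace IsCompactSymmGen

variable {G : Type*} [Group G] [TopologicalSpace G] {S : Set G}

theorem inv_mem_pow (hS : IsCompactSymmGen S) {n : ℕ} {g : G} (hg : g ∈ S ^ n) : g⁻¹ ∈ S ^ n := by
  rw [← hS.symm, inv_pow]
  exact Set.inv_mem_inv.2 hg

theorem exists_mem_pow (hS : IsCompactSymmGen S) (g : G) : ∃ n : ℕ, g ∈ S ^ n :=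
  mem_iUnion.1 (hS.iUnion_pow ▸ mem_univ g)

variable [IsTopologicalGroup G]

theorem isCompact_pow (hS : IsCompactSymmGen S) (n : ℕ) : IsCompact (S ^ n) := by
  induction n with
  | zero => rw [pow_zero]; exact isCompact_singleton
  | succ n ih => rw [pow_succ]; exact ih.mul hS.isCompact

theorem sigmaCompactSpace (hS : IsCompactSymmGen S) : SigmaCompactSpace G :=
  ⟨⟨fun n => S ^ n, hS.isCompact_pow, hS.iUnion_pow⟩⟩

/-- Compact sets are contained in balls of the word metric. -/
theorem exists_subset_biUnion_pow [LocallyCompactSpace G] [T2Space G] (hS : IsCompactSymmGen S)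
    {K : Set G} (hK : IsCompact K) : ∃ m : ℕ, ∀ g ∈ K, ∃ n ≤ m, g ∈ S ^ n := by
  -- By the Baire category theorem some power of S has interior; finitely many translates of that
  -- interior cover K.
  obtain ⟨i, g₀, hg₀⟩ := nonempty_interior_of_iUnion_of_closed
    (fun n => (hS.isCompact_pow n).isClosed) hS.iUnion_pow
  have hopen : ∀ g : G, IsOpen ((g * g₀⁻¹) • interior (S ^ i)) := fun g =>
    isOpen_interior.smul _
  obtain ⟨t, ht⟩ := hK.elim_finite_subcover (fun g : G => (g * g₀⁻¹) • interior (S ^ i)) hopen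
    fun g _ => mem_iUnion.2 ⟨g, g₀, hg₀, by simp⟩
  choose l hl using hS.exists_mem_pow
  refine ⟨t.sup fun g => l (g * g₀⁻¹) + i, fun g hg => ?_⟩
  obtain ⟨a, hat, ha⟩ := mem_iUnion₂.1 (ht hg)
  obtain ⟨y, hy, rfl⟩ := ha
  refine ⟨l (a * g₀⁻¹) + i, Finset.le_sup (f := fun g => l (g * g₀⁻¹) + i) hat, ?_⟩
  rw [pow_add]
  exact mul_mem_mul (hl _) (interior_subset hy)

theorem exists_eLpNorm_translate_sub_le [LocallyCompactSpace G] [T2Space G] [MeasurableSpace G]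
    [BorelSpace G] {μ : Measure G} [μ.IsHaarMeasure] [μ.Regular] (hS : IsCompactSymmGen S)
    {p : ℝ≥0∞} (hp : 1 ≤ p) {K : Set G} (hK : IsCompact K) :
    ∃ c : ℝ≥0, ∀ f : G → ℝ, Measurable f → ∀ u ∈ K,
      eLpNorm (fun x => f (x * u) - f x) p μ ≤ c * rightTransNorm S μ p f := by
  obtain ⟨m, hm⟩ := hS.exists_subset_biUnion_pow hK
  choose c hc using _root_.exists_eLpNorm_translate_sub_le μ hS.isCompact hp
  refine ⟨(Finset.range (m + 1)).sup c, fun f hf u hu => ?_⟩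
  obtain ⟨n, hn, hun⟩ := hm u hu
  refine (hc n f hf u hun).trans ?_
  gcongr
  exact Finset.le_sup (f := c) (Finset.mem_range.2 (by omega))

end IsCompactSymmGen

theorem BaireMeas.enorm {X : Type*} [TopologicalSpace X] {f : X → ℝ} (hf : BaireMeas f) :
    BaireMeas fun x => ‖f x‖ₑ := by
  let := baireAlgebra X
  exact Measurable.enorm hf

theorem BaireMeas.sub {X : Type*} [TopologicalSpace X] {f g : X → ℝ} (hf : BaireMeas f)
    (hg : BaireMeas g) : BaireMeas fun x => f x - g x := by
  let := baireAlgebra X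
  exact Measurable.sub hf hg

/-! ### Averages, oscillations and trimmed averages -/

section Operators

variable {G : Type*} [Group G] [MeasurableSpace G] (μ : Measure G)

/-- The unnormalized average of `|f|` over `x U`. -/
noncomputable def avgOn (U : Set G) (f : G → ℝ) (x : G) : ℝ≥0∞ := ∫⁻ u in U, ‖f (x * u)‖ₑ ∂μ

/-- The mean oscillation of `f` over `x V`. -/
noncomputable def oscOn (V : Set G) (f : G → ℝ) (x : G) : ℝ≥0∞ :=
  ∫⁻ u in V, ∫⁻ w in V, ‖f (x * u) - f (x * w)‖ₑ ∂μ ∂μ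

/-- The average with a multiple of the oscillation subtracted; it vanishes at `x` unless `f` is
nonzero on a large part of `x U`. -/
noncomputable def trimmedAvg (U : Set G) (f : G → ℝ) (x : G) : ℝ≥0∞ :=
  avgOn μ U f x - 2 / μ U * oscOn μ U f x

variable {μ}

theorem oscOn_mono {U V : Set G} (h : U ⊆ V) (f : G → ℝ) (x : G) :
    oscOn μ U f x ≤ oscOn μ V f x :=
  (lintegral_mono fun _ => lintegral_mono_set h).trans (lintegral_mono_set h)

variable [TopologicalSpace G] [IsTopologicalGroup G] [BorelSpace G]

theorem setLIntegral_mul_left [μ.IsMulLeftInvariant] (φ : G → ℝ≥0∞) (t : G) (U : Set G) :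
    ∫⁻ u in U, φ (t * u) ∂μ = ∫⁻ u in t • U, φ u ∂μ := by
  have h := (measurePreserving_mul_left μ t).setLIntegral_comp_emb
    (measurableEmbedding_mulLeft t) φ U
  rw [h]
  rfl

theorem avgOn_mul [μ.IsMulLeftInvariant] (U : Set G) (f : G → ℝ) (x t : G) :
    avgOn μ U f (x * t) = avgOn μ (t • U) f x := by
  simp only [avgOn, mul_assoc]
  exact setLIntegral_mul_left (fun u => ‖f (x * u)‖ₑ) t U

theorem oscOn_mul [μ.IsMulLeftInvariant] (U : Set G) (f : G → ℝ) (x t : G) :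
    oscOn μ U f (x * t) = oscOn μ (t • U) f x := by
  simp only [oscOn, mul_assoc]
  rw [← setLIntegral_mul_left (fun u => ∫⁻ w in t • U, ‖f (x * u) - f (x * w)‖ₑ ∂μ) t U]
  refine lintegral_congr fun u => ?_
  exact setLIntegral_mul_left (fun w => ‖f (x * (t * u)) - f (x * w)‖ₑ) t U

/-- Integrate |f(xu)| ≤ |f(xu) − f(xw)| + |f(xw)| over u ∈ U₁ and w ∈ U₂. -/
theorem avgOn_mul_measure_le [SFinite μ] {f : G → ℝ} (hf : Measurable f) {U₁ U₂ V : Set G}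
    (h₁ : U₁ ⊆ V) (h₂ : U₂ ⊆ V) (x : G) :
    avgOn μ U₁ f x * μ U₂ ≤ oscOn μ V f x + μ U₁ * avgOn μ U₂ f x := by
  have hm : ∀ a : G, Measurable fun u => f (a * u) := fun a => hf.comp (measurable_const_mul a)
  calc avgOn μ U₁ f x * μ U₂ = ∫⁻ u in U₁, ∫⁻ _ in U₂, ‖f (x * u)‖ₑ ∂μ ∂μ := by
        simp only [setLIntegral_const]
        rw [lintegral_mul_const _ (hm x).enorm]; rfl
    _ ≤ ∫⁻ u in U₁, ((∫⁻ w in U₂, ‖f (x * u) - f (x * w)‖ₑ ∂μ) + avgOn μ U₂ f x) ∂μ := by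
        refine lintegral_mono fun u => ?_
        rw [avgOn, ← lintegral_add_right _ (hm x).enorm]
        refine lintegral_mono fun w => ?_
        simpa using enorm_add_le (f (x * u) - f (x * w)) (f (x * w))
    _ = (∫⁻ u in U₁, ∫⁻ w in U₂, ‖f (x * u) - f (x * w)‖ₑ ∂μ ∂μ) + μ U₁ * avgOn μ U₂ f x := by
        rw [lintegral_add_right _ measurable_const, setLIntegral_const, mul_comm (μ U₁)]
    _ ≤ _ := by
        gcongr
        exact (lintegral_mono fun _ => lintegral_mono_set h₂).trans (lintegral_mono_set h₁)

theorem avgOn_le [SFinite μ] {f : G → ℝ} (hf : Measurable f) {U₁ U₂ V : Set G}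
    (h₁ : U₁ ⊆ V) (h₂ : U₂ ⊆ V) (h12 : μ U₁ = μ U₂) (h0 : μ U₂ ≠ 0) (ht : μ U₂ ≠ ∞) (x : G) :
    avgOn μ U₁ f x ≤ avgOn μ U₂ f x + 1 / μ U₂ * oscOn μ V f x := by
  have h := avgOn_mul_measure_le (μ := μ) hf h₁ h₂ x
  rw [h12] at h
  rw [← ENNReal.mul_le_mul_iff_left h0 ht]
  refine h.trans (le_of_eq ?_)
  rw [add_mul, mul_right_comm, one_div, ENNReal.inv_mul_cancel h0 ht, one_mul, add_comm, mul_comm]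

/-- Of the constant 3, one unit compares the averages over xU and xtU, and two units pay for the
oscillation subtracted at xt. The error term is free of t, which later allows a supremum over t
inside the norm. -/
theorem trimmedAvg_le_mul [SFinite μ] [μ.IsMulLeftInvariant] {f : G → ℝ} (hf : Measurable f)
    {U V : Set G} (h0 : μ U ≠ 0) (ht : μ U ≠ ∞) (hUV : U ⊆ V) {t : G} (htV : t • U ⊆ V) (x : G) :
    trimmedAvg μ U f x ≤ trimmedAvg μ U f (x * t) + 3 / μ U * oscOn μ V f x := by
  have h1 : μ U = μ (t • U) := (measure_smul μ t U).symm
  have h2 := avgOn_le hf hUV htV h1 (h1 ▸ h0) (h1 ▸ ht) x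
  have h3 : (3 : ℝ≥0∞) / μ U = 2 / μ U + 1 / μ U := by
    rw [← ENNReal.add_div]; norm_num
  calc trimmedAvg μ U f x ≤ avgOn μ U f x := tsub_le_self
    _ ≤ avgOn μ U f (x * t) + 1 / μ U * oscOn μ V f x := by rwa [avgOn_mul, h1]
    _ ≤ trimmedAvg μ U f (x * t) + 2 / μ U * oscOn μ U f (x * t) + 1 / μ U * oscOn μ V f x := by
        gcongr; exact le_tsub_add
    _ ≤ trimmedAvg μ U f (x * t) + 2 / μ U * oscOn μ V f x + 1 / μ U * oscOn μ V f x := by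
        gcongr; rw [oscOn_mul]; exact oscOn_mono htV f x
    _ = _ := by rw [h3]; ring

theorem trimmedAvg_mul_le [SFinite μ] [μ.IsMulLeftInvariant] {f : G → ℝ} (hf : Measurable f)
    {U V : Set G} (h0 : μ U ≠ 0) (ht : μ U ≠ ∞) (hUV : U ⊆ V) {t : G} (htV : t • U ⊆ V) (x : G) :
    trimmedAvg μ U f (x * t) ≤ trimmedAvg μ U f x + 3 / μ U * oscOn μ V f x := by
  have h2 := avgOn_le hf htV hUV (measure_smul μ t U) h0 ht x
  have h3 : (3 : ℝ≥0∞) / μ U = 2 / μ U + 1 / μ U := by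
    rw [← ENNReal.add_div]; norm_num
  calc trimmedAvg μ U f (x * t) ≤ avgOn μ U f (x * t) := tsub_le_self
    _ ≤ avgOn μ U f x + 1 / μ U * oscOn μ V f x := by rwa [avgOn_mul]
    _ ≤ trimmedAvg μ U f x + 2 / μ U * oscOn μ U f x + 1 / μ U * oscOn μ V f x := by
        gcongr; exact le_tsub_add
    _ ≤ trimmedAvg μ U f x + 2 / μ U * oscOn μ V f x + 1 / μ U * oscOn μ V f x := by
        gcongr; exact oscOn_mono hUV f x
    _ = _ := by rw [h3]; ring

/-- If f vanished on more than half of xU, comparing each value with the zeros would bound the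
average by 2 / μ U times the oscillation, and the truncated difference would be 0. This fixes the
coefficient in `trimmedAvg`. -/
theorem measure_le_of_trimmedAvg_ne_zero [SFinite μ] {f : G → ℝ} (hf : Measurable f) {U : Set G}
    (hU : MeasurableSet U) (h0 : μ U ≠ 0) (ht : μ U ≠ ∞) {x : G} (hx : trimmedAvg μ U f x ≠ 0) :
    μ U ≤ 2 * μ (U ∩ {u | f (x * u) ≠ 0}) := by
  by_contra! hlt
  refine hx (tsub_eq_zero_of_le ?_)
  set A : Set G := U ∩ {u | f (x * u) ≠ 0}
  set B : Set G := U ∩ {u | f (x * u) = 0}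
  have hm : Measurable fun u => f (x * u) := hf.comp (measurable_const_mul x)
  have hAB : μ U = μ A + μ B := by
    have h := measure_inter_add_sdiff (μ := μ) U (t := {u | f (x * u) = 0})
      (hm (measurableSet_singleton 0))
    rw [← h, add_comm]; rfl
  have hA : μ A ≠ ∞ := ne_top_of_le_ne_top ht (measure_mono inter_subset_left)
  have hB : μ U ≤ 2 * μ B := by
    rw [hAB, two_mul] at hlt
    have := (ENNReal.add_lt_add_iff_left hA).1 hlt
    rw [hAB, two_mul]; gcongr
  have h1 : avgOn μ U f x * μ B ≤ oscOn μ U f x := by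
    calc avgOn μ U f x * μ B = ∫⁻ u in U, ∫⁻ _ in B, ‖f (x * u)‖ₑ ∂μ ∂μ := by
          simp only [setLIntegral_const]
          rw [lintegral_mul_const _ hm.enorm]; rfl
      _ = ∫⁻ u in U, ∫⁻ w in B, ‖f (x * u) - f (x * w)‖ₑ ∂μ ∂μ := by
          refine lintegral_congr fun u => ?_
          refine setLIntegral_congr_fun (hU.inter (hm (measurableSet_singleton 0))) fun w hw => ?_
          have : f (x * w) = 0 := hw.2
          simp only [this, sub_zero]
      _ ≤ _ := lintegral_mono fun _ => lintegral_mono_set inter_subset_left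
  rw [← ENNReal.mul_le_mul_iff_left h0 ht]
  calc avgOn μ U f x * μ U ≤ avgOn μ U f x * (2 * μ B) := by gcongr
    _ = 2 * (avgOn μ U f x * μ B) := by ring
    _ ≤ 2 * oscOn μ U f x := by gcongr
    _ = 2 / μ U * oscOn μ U f x * μ U := by
        rw [mul_right_comm, ENNReal.div_mul_cancel h0 ht]

/-- Regularization loses only oscillation terms; this will keep ‖F‖_p comparable to ‖f‖_p when N(f)
is small. -/
theorem measure_mul_enorm_le [SFinite μ] {f : G → ℝ} (hf : Measurable f) {U : Set G} (x : G) :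
    μ U * ‖f x‖ₑ ≤ trimmedAvg μ U f x + 2 / μ U * oscOn μ U f x +
      ∫⁻ u in U, ‖f (x * u) - f x‖ₑ ∂μ := by
  have hm : Measurable fun u => f (x * u) := hf.comp (measurable_const_mul x)
  calc μ U * ‖f x‖ₑ = ∫⁻ _ in U, ‖f x‖ₑ ∂μ := by rw [setLIntegral_const, mul_comm]
    _ ≤ ∫⁻ u in U, (‖f (x * u)‖ₑ + ‖f (x * u) - f x‖ₑ) ∂μ := by
        refine lintegral_mono fun u => ?_
        simpa using enorm_sub_le (a := f (x * u)) (b := f (x * u) - f x)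
    _ = avgOn μ U f x + ∫⁻ u in U, ‖f (x * u) - f x‖ₑ ∂μ := lintegral_add_left hm.enorm _
    _ ≤ _ := by gcongr; exact le_tsub_add

variable [LocallyCompactSpace G] [T2Space G] [SigmaCompactSpace G]

theorem BaireMeas.avgOn [SFinite μ] {f : G → ℝ} (hf : BaireMeas f) (U : Set G) :
    BaireMeas (avgOn μ U f) := by
  refine BaireMeas.lintegral_right (F := fun q : G × G => ‖f (q.1 * q.2)‖ₑ) ?_
  exact (hf.comp continuous_mul).enorm

theorem BaireMeas.oscOn [SFinite μ] {f : G → ℝ} (hf : BaireMeas f) (U : Set G) :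
    BaireMeas (oscOn μ U f) := by
  refine BaireMeas.lintegral_right
    (F := fun q : G × G => ∫⁻ w in U, ‖f (q.1 * q.2) - f (q.1 * w)‖ₑ ∂μ) ?_
  refine BaireMeas.lintegral_right
    (F := fun q : (G × G) × G => ‖f (q.1.1 * q.1.2) - f (q.1.1 * q.2)‖ₑ) ?_
  exact BaireMeas.enorm (BaireMeas.sub
    (hf.comp (Φ := fun q : (G × G) × G => q.1.1 * q.1.2) (by fun_prop))
    (hf.comp (Φ := fun q : (G × G) × G => q.1.1 * q.2) (by fun_prop)))

theorem BaireMeas.trimmedAvg [SFinite μ] {f : G → ℝ} (hf : BaireMeas f) (U : Set G) :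
    BaireMeas (trimmedAvg μ U f) :=
  Measurable.sub (hf.avgOn U) (Measurable.const_mul (hf.oscOn U) _)

theorem eLpNorm_setLIntegral_translate_sub_le [SigmaFinite μ] {p : ℝ≥0∞} (hp : 1 ≤ p) {f : G → ℝ}
    (hf : BaireMeas f) {U : Set G} (hU : MeasurableSet U) (ht : μ U ≠ ∞) {L : ℝ≥0∞}
    (hL : ∀ u ∈ U, eLpNorm (fun x => f (x * u) - f x) p μ ≤ L) :
    eLpNorm (fun x => ∫⁻ u in U, ‖f (x * u) - f x‖ₑ ∂μ) p μ ≤ μ U * L := by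
  have : IsFiniteMeasure (μ.restrict U) := isFiniteMeasure_restrict.2 ht
  have h := eLpNorm_lintegral_le (μ := μ) (κ := μ.restrict U) hp (L := L)
    (k := fun q : G × G => ‖f (q.1 * q.2) - f q.1‖ₑ)
    ((hf.comp_continuous continuous_mul).sub (hf.comp_continuous continuous_fst)).enorm
    ((ae_restrict_iff' hU).2 (ae_of_all _ fun u hu => by
      simpa only [eLpNorm_enorm] using hL u hu))
  simpa using h

theorem eLpNorm_oscOn_le [SigmaFinite μ] {p : ℝ≥0∞} (hp : 1 ≤ p) {f : G → ℝ}
    (hf : BaireMeas f) {V : Set G} (hV : MeasurableSet V) (ht : μ V ≠ ∞) {L : ℝ≥0∞}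
    (hL : ∀ u ∈ V, eLpNorm (fun x => f (x * u) - f x) p μ ≤ L) :
    eLpNorm (oscOn μ V f) p μ ≤ μ V * (μ V * (L + L)) := by
  have : IsFiniteMeasure (μ.restrict V) := isFiniteMeasure_restrict.2 ht
  have hm : ∀ a : G, Measurable fun x => f (x * a) := fun a =>
    hf.comp_continuous (continuous_mul_const a)
  have h := eLpNorm_lintegral_le (μ := μ) (κ := μ.restrict V) hp (L := μ V * (L + L))
    (k := fun q : G × G => ∫⁻ w in V, ‖f (q.1 * q.2) - f (q.1 * w)‖ₑ ∂μ) ?_ ?_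
  · rwa [Measure.restrict_apply_univ] at h
  · exact Measurable.lintegral_prod_right'
      (f := fun q : (G × G) × G => ‖f (q.1.1 * q.1.2) - f (q.1.1 * q.2)‖ₑ)
      (Measurable.enorm ((hf.comp_continuous (by fun_prop)).sub
        (hf.comp_continuous (by fun_prop))))
  · refine (ae_restrict_iff' hV).2 (ae_of_all _ fun u hu => ?_)
    have h := eLpNorm_lintegral_le (μ := μ) (κ := μ.restrict V) hp (L := L + L)
      (k := fun q : G × G => ‖f (q.1 * u) - f (q.1 * q.2)‖ₑ) ?_ ?_
    · simpa using h
    · exact Measurable.enorm ((hf.comp_continuous (by fun_prop)).sub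
        (hf.comp_continuous (by fun_prop)))
    · refine (ae_restrict_iff' hV).2 (ae_of_all _ fun w hw => ?_)
      simp only [eLpNorm_enorm]
      have h1 : (fun x => f (x * u) - f (x * w)) =
          (fun x => f (x * u) - f x) - fun x => f (x * w) - f x := by
        ext x; simp
      rw [h1]
      exact (eLpNorm_sub_le ((hm u).sub hf.measurable).aestronglyMeasurable
        ((hm w).sub hf.measurable).aestronglyMeasurable hp).trans
        (add_le_add (hL u hu) (hL w hw))

omit [LocallyCompactSpace G] [T2Space G] [SigmaCompactSpace G] in
theorem avgOn_lt_top [μ.IsMulLeftInvariant] {f : G → ℝ} (hf : LocallyIntegrable f μ) {U : Set G}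
    (hU : IsCompact U) (x : G) : avgOn μ U f x < ∞ := by
  rw [avgOn, setLIntegral_mul_left (fun u => ‖f u‖ₑ) x U]
  exact (hf.integrableOn_isCompact (hU.smul x)).2

end Operators

/-! ### Invariant measures on the quotient and modular functions -/

section Quotient

variable {G : Type*} [Group G] [TopologicalSpace G] [IsTopologicalGroup G]
    [LocallyCompactSpace G] [T2Space G] [MeasurableSpace G] [BorelSpace G] {H : Subgroup G}
    (ν : Measure H)

/-- The function `x H ↦ ∫ h, f (x h) ∂ν` on `G ⧸ H`. -/
noncomputable def fiberIntegral (f : G → ℝ) (q : G ⧸ H) : ℝ := ∫ h : H, f (q.out * h) ∂ν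

variable [ν.IsHaarMeasure]

omit [LocallyCompactSpace G] [T2Space G] in
theorem fiberIntegral_mk (f : G → ℝ) (x : G) :
    fiberIntegral ν f (x : G ⧸ H) = ∫ h : H, f (x * h) ∂ν := by
  obtain ⟨h₀, hh₀⟩ := QuotientGroup.mk_out_eq_mul H x
  rw [fiberIntegral, hh₀, ← integral_mul_left_eq_self (fun h : H => f (x * h)) h₀]
  simp [mul_assoc]

omit [T2Space G] in
theorem continuous_fiberIntegral (hH : IsClosed (H : Set G)) {f : G → ℝ} (hf : Continuous f)
    (hfs : HasCompactSupport f) : Continuous (fiberIntegral ν f) := by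
  rw [(QuotientGroup.isQuotientMap_mk H).continuous_iff]
  refine (continuous_integral_comp_mul (j := H.subtype) (ν := ν)
    hH.isClosedEmbedding_subtypeVal hf hfs).congr fun x => ?_
  exact (fiberIntegral_mk ν f x).symm

omit [LocallyCompactSpace G] [T2Space G] in
theorem hasCompactSupport_fiberIntegral (hH : IsClosed (H : Set G)) {f : G → ℝ}
    (hfs : HasCompactSupport f) : HasCompactSupport (fiberIntegral ν f) := by
  have hK : IsCompact ((fun x : G => (x : G ⧸ H)) '' tsupport f) :=
    IsCompact.image hfs continuous_quot_mk
  refine HasCompactSupport.intro' hK ?_ fun q hq => ?_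
  · rw [← (QuotientGroup.isQuotientMap_mk H).isClosed_preimage]
    have : ((fun x : G => (x : G ⧸ H)) ⁻¹' ((fun x : G => (x : G ⧸ H)) '' tsupport f)) =
        tsupport f * (H : Set G) := QuotientGroup.preimage_image_mk_eq_mul H _
    rw [this]
    exact hH.mul_left_of_isCompact hfs
  · induction q using QuotientGroup.induction_on with
    | H x =>
      rw [fiberIntegral_mk]
      refine (integral_congr_ae (ae_of_all _ fun h => ?_)).trans (integral_zero _ _)
      by_contra hne
      refine hq ⟨x * h, subset_tsupport _ hne, ?_⟩
      simp

open Measure in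
/-- If `G ⧸ H` carries a nonzero invariant Radon measure, then the modular functions agree. -/
theorem modularCharacterFun_eq_of_carriesInvariantMeasure [SigmaCompactSpace G] [ν.Regular]
    [LocallyCompactSpace H]
    (μ : Measure G) [μ.IsHaarMeasure] [μ.Regular] (hH : IsClosed (H : Set G))
    (hm : CarriesInvariantMeasure H) (h₀ : H) :
    modularCharacterFun h₀ = modularCharacterFun (h₀ : G) := by
  let : MeasurableSpace (G ⧸ H) := borel (G ⧸ H)
  have : BorelSpace (G ⧸ H) := ⟨rfl⟩
  obtain ⟨m, hreg, hm0, hminv⟩ := hm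
  have hint : ∀ f : CompactlySupportedContinuousMap G ℝ, Integrable (fiberIntegral ν f) m :=
    fun f => (continuous_fiberIntegral ν hH (map_continuous f) f.2).integrable_of_hasCompactSupport
      (hasCompactSupport_fiberIntegral ν hH f.2)
  have hintH : ∀ (f : CompactlySupportedContinuousMap G ℝ) (x : G),
      Integrable (fun h : H => f (x * h)) ν := fun f x => by
    refine Continuous.integrable_of_hasCompactSupport (by fun_prop) ?_
    exact f.2.comp_isClosedEmbedding
      ((Homeomorph.mulLeft x).isClosedEmbedding.comp hH.isClosedEmbedding_subtypeVal)
  let Λ : CompactlySupportedContinuousMap G ℝ →ₚ[ℝ] ℝ := PositiveLinearMap.mk₀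
    { toFun := fun f => ∫ q, fiberIntegral ν f q ∂m
      map_add' := fun f g => by
        rw [← integral_add (hint f) (hint g)]
        refine integral_congr_ae (ae_of_all _ fun q => ?_)
        exact integral_add (hintH f q.out) (hintH g q.out)
      map_smul' := fun c f => by
        rw [RingHom.id_apply, smul_eq_mul, ← integral_const_mul]
        refine integral_congr_ae (ae_of_all _ fun q => ?_)
        exact integral_const_mul _ _ }
    fun f hf => integral_nonneg fun q => integral_nonneg fun h => hf _
  let lam : Measure G := RealRMK.rieszMeasure Λ
  have hlam : ∀ f : CompactlySupportedContinuousMap G ℝ,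
      ∫ x, f x ∂lam = ∫ q, fiberIntegral ν f q ∂m := fun f => RealRMK.integral_rieszMeasure Λ f
  let tl : G → CompactlySupportedContinuousMap G ℝ → CompactlySupportedContinuousMap G ℝ :=
    fun g f => ⟨⟨fun x => f (g * x), by fun_prop⟩, f.2.comp_homeomorph (Homeomorph.mulLeft g)⟩
  let tr : G → CompactlySupportedContinuousMap G ℝ → CompactlySupportedContinuousMap G ℝ :=
    fun g f => ⟨⟨fun x => f (x * g), by fun_prop⟩, f.2.comp_homeomorph (Homeomorph.mulRight g)⟩
  have hinv : lam.IsMulLeftInvariant := by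
    refine ⟨fun g => ?_⟩
    have : (map (g * ·) lam).Regular := Regular.map (Homeomorph.mulLeft g)
    refine Measure.ext_of_integral_eq_on_compactlySupported fun f => ?_
    rw [integral_map (measurable_const_mul g).aemeasurable (map_continuous f).aestronglyMeasurable]
    refine (hlam (tl g f)).trans (Eq.trans ?_ (hlam f).symm)
    have h1 : ∀ q : G ⧸ H, fiberIntegral ν (tl g f) q = fiberIntegral ν f (g • q) := fun q => by
      induction q using QuotientGroup.induction_on with
      | H x =>
        have h2 : g • (x : G ⧸ H) = ((g * x : G) : G ⧸ H) := rfl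
        rw [h2, fiberIntegral_mk, fiberIntegral_mk]
        refine integral_congr_ae (ae_of_all _ fun h => ?_)
        change f (g * (x * h)) = f (g * x * h)
        rw [mul_assoc]
    simp_rw [h1]
    conv_rhs => rw [← hminv g]
    rw [integral_map]
    · exact (continuous_const_smul g).measurable.aemeasurable
    · exact (continuous_fiberIntegral ν hH (map_continuous f) f.2).aestronglyMeasurable
  -- A cutoff equal to 1 on a compact set whose image in G ⧸ H has nonzero measure.
  obtain ⟨f, hfpos⟩ : ∃ f : CompactlySupportedContinuousMap G ℝ,
      0 < ∫ q, fiberIntegral ν f q ∂m := by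
    have hcov : ⋃ n, (fun x : G => (x : G ⧸ H)) '' compactCovering G n = univ := by
      rw [← image_iUnion, iUnion_compactCovering, image_univ]
      exact (QuotientGroup.mk_surjective).range_eq
    obtain ⟨n, hn⟩ : ∃ n, m ((fun x : G => (x : G ⧸ H)) '' compactCovering G n) ≠ 0 := by
      by_contra! hall
      refine hm0 (Measure.measure_univ_eq_zero.1 ?_)
      rw [← hcov]
      exact measure_iUnion_null hall
    obtain ⟨f, hf1, -, hfs, hf01⟩ := exists_continuous_one_zero_of_isCompact
      (isCompact_compactCovering G n) isClosed_empty (disjoint_empty _)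
    refine ⟨⟨f, hfs⟩, ?_⟩
    have hnn : 0 ≤ fiberIntegral ν (H := H) f :=
      fun q => integral_nonneg fun h => (hf01 _).1
    refine (integral_pos_iff_support_of_nonneg hnn (hint ⟨f, hfs⟩)).2 ?_
    refine (pos_iff_ne_zero.2 hn).trans_le (measure_mono ?_)
    rintro _ ⟨x, hx, rfl⟩
    refine ne_of_gt ?_
    change 0 < fiberIntegral ν f (x : G ⧸ H)
    rw [fiberIntegral_mk]
    refine Continuous.integral_pos_of_hasCompactSupport_nonneg_nonzero (x := 1) (by fun_prop) ?_
      (fun h => (hf01 _).1) ?_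
    · exact hfs.comp_isClosedEmbedding
        ((Homeomorph.mulLeft x).isClosedEmbedding.comp hH.isClosedEmbedding_subtypeVal)
    · simp [hf1 hx]
  have hΛμ : ∀ f : CompactlySupportedContinuousMap G ℝ,
      ∫ q, fiberIntegral ν f q ∂m = haarScalarFactor lam μ * ∫ x, f x ∂μ := fun f => by
    rw [← hlam, integral_isMulLeftInvariant_eq_smul_of_hasCompactSupport lam μ (map_continuous f) f.2,
      integral_smul_nnreal_measure]
    rfl
  -- A right translation by h₀ scales the same integral by the modular function of G, seen on G, and
  -- by that of H, seen on each fiber.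
  have h1 : ∫ q, fiberIntegral ν (tr h₀ f) q ∂m =
      modularCharacterFun (h₀ : G) * ∫ q, fiberIntegral ν f q ∂m := by
    rw [hΛμ, hΛμ, mul_left_comm, ← integral_mul_right_eq μ f h₀]
    rfl
  have h2 : ∫ q, fiberIntegral ν (tr h₀ f) q ∂m =
      modularCharacterFun h₀ * ∫ q, fiberIntegral ν f q ∂m := by
    rw [← integral_const_mul]
    refine integral_congr_ae (ae_of_all _ fun q => ?_)
    change ∫ h : H, f (q.out * h * h₀) ∂ν = modularCharacterFun h₀ * ∫ h : H, f (q.out * h) ∂ν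
    rw [← integral_mul_right_eq ν (fun h : H => f (q.out * h)) h₀]
    simp [mul_assoc]
  rw [h1] at h2
  exact_mod_cast (mul_right_cancel₀ hfpos.ne' h2).symm

end Quotient

/-! ### Haar measure under inversion -/

section Inversion

open Measure

variable {G : Type*} [Group G] [TopologicalSpace G] [IsTopologicalGroup G] [LocallyCompactSpace G]
  [MeasurableSpace G] [BorelSpace G] (μ : Measure G) [μ.IsHaarMeasure] [μ.Regular]

/-- Inverting the variable turns left Haar measure into a multiple of `Δ` times Haar measure. -/
theorem exists_lintegral_modular_inv_eq : ∃ c : ℝ≥0, c ≠ 0 ∧ ∀ ψ : G → ℝ, Continuous ψ →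
    HasCompactSupport ψ → 0 ≤ ψ →
    ∫⁻ x, modularCharacterFun x * ENNReal.ofReal (ψ x⁻¹) ∂μ
      = c * ∫⁻ x, ENNReal.ofReal (ψ x) ∂μ := by
  have hδ := continuous_modularCharacterFun μ
  let δ : G → ℝ≥0∞ := fun x => (modularCharacterFun x : ℝ≥0)
  have hδm : Measurable δ := (ENNReal.continuous_coe.comp hδ).measurable
  -- The density Δ makes the inverted measure left-invariant, hence proportional to μ on compactly
  -- supported continuous functions. The value of the constant is never needed.
  let μ' : Measure G := (μ.withDensity δ).inv
  have hμ' : ∀ φ : G → ℝ≥0∞, Measurable φ → ∫⁻ x, φ x ∂μ' = ∫⁻ x, δ x * φ x⁻¹ ∂μ := fun φ hφ => by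
    have h : ∫⁻ x, φ x ∂μ' = ∫⁻ x, φ x⁻¹ ∂(μ.withDensity δ) :=
      lintegral_map hφ measurable_inv
    exact h.trans (lintegral_withDensity_eq_lintegral_mul μ hδm (hφ.comp measurable_inv))
  have : IsLocallyFiniteMeasure (μ.withDensity δ) := IsLocallyFiniteMeasure.withDensity_coe hδ
  have : (μ.withDensity δ).IsOpenPosMeasure := by
    refine AbsolutelyContinuous.isOpenPosMeasure (μ := μ) ?_
    exact withDensity_absolutelyContinuous' hδm.aemeasurable (ae_of_all _ fun x => by
      simpa [δ] using (modularCharacterFun_pos x).ne')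
  have hfin : IsFiniteMeasureOnCompacts μ' := inferInstance
  have hpos : μ'.IsOpenPosMeasure := inferInstance
  have hinv : μ'.IsMulLeftInvariant := by
    refine ⟨fun k => Measure.ext fun A hA => ?_⟩
    have hφ : Measurable (A.indicator (1 : G → ℝ≥0∞)) := measurable_one.indicator hA
    rw [← lintegral_indicator_one hA, ← lintegral_indicator_one hA,
      lintegral_map hφ (measurable_const_mul k), hμ' _ hφ,
      hμ' (fun x => A.indicator 1 (k * x)) (hφ.comp (measurable_const_mul k))]
    have h := lintegral_mul_right_eq μ
      (fun x => δ (x * k) * A.indicator (1 : G → ℝ≥0∞) x⁻¹) k⁻¹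
    simp only [inv_mul_cancel_right, mul_inv_rev, inv_inv] at h
    rw [h]
    have h2 : ∀ x, δ (x * k) * A.indicator (1 : G → ℝ≥0∞) x⁻¹ =
        δ k * (δ x * A.indicator (1 : G → ℝ≥0∞) x⁻¹) := fun x => by
      simp only [δ, modularCharacterFun_map_mul, ENNReal.coe_mul]; ring
    simp_rw [h2]
    rw [lintegral_const_mul' _ _ ENNReal.coe_ne_top, ← mul_assoc]
    have h3 : (modularCharacterFun k⁻¹ : ℝ≥0∞) * δ k = 1 := by
      simp only [δ]
      rw [← ENNReal.coe_mul, ← modularCharacterFun_map_mul, inv_mul_cancel,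
        modularCharacterFun_map_one, ENNReal.coe_one]
    rw [h3, one_mul]
  have : μ'.IsHaarMeasure := {}
  refine ⟨haarScalarFactor μ' μ, (haarScalarFactor_pos_of_isHaarMeasure μ' μ).ne',
    fun ψ hψ hψs hψ0 => ?_⟩
  have h1 := integral_isMulLeftInvariant_eq_smul_of_hasCompactSupport μ' μ hψ hψs
  have h2 : ENNReal.ofReal (∫ x, ψ x ∂μ') =
      ENNReal.ofReal (∫ x, ψ x ∂(haarScalarFactor μ' μ • μ)) := by rw [h1]
  rw [ofReal_integral_eq_lintegral_ofReal (hψ.integrable_of_hasCompactSupport hψs)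
      (ae_of_all _ hψ0), hμ' _ hψ.measurable.ennreal_ofReal,
    ofReal_integral_eq_lintegral_ofReal (hψ.integrable_of_hasCompactSupport hψs)
      (ae_of_all _ hψ0), lintegral_smul_measure] at h2
  exact h2

/-- The Haar measure of a unimodular group is invariant under inversion. -/
theorem isInvInvariant_of_isMulRightInvariant [μ.IsMulRightInvariant] : μ.IsInvInvariant := by
  have h := isMulLeftInvariant_eq_smul_of_regular μ.inv μ
  obtain ⟨K, hK, hK1⟩ := exists_compact_mem_nhds (1 : G)
  have hs : (K ∩ K⁻¹)⁻¹ = K ∩ K⁻¹ := by rw [Set.inter_inv, inv_inv, inter_comm]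
  have hn : K ∩ K⁻¹ ∈ nhds (1 : G) := inter_mem hK1 (inv_mem_nhds_one G hK1)
  have h0 : μ (K ∩ K⁻¹) ≠ 0 := (measure_pos_of_mem_nhds μ hn).ne'
  have ht : μ (K ∩ K⁻¹) ≠ ∞ :=
    ne_top_of_le_ne_top hK.measure_lt_top.ne (measure_mono inter_subset_left)
  -- A symmetric neighborhood of finite positive measure forces the scalar to be 1.
  have h1 : μ (K ∩ K⁻¹) = haarScalarFactor μ.inv μ * μ (K ∩ K⁻¹) := by
    have h2 : μ.inv (K ∩ K⁻¹) = (haarScalarFactor μ.inv μ • μ) (K ∩ K⁻¹) := by rw [← h]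
    rw [Measure.inv_apply, hs] at h2
    exact h2
  have h3 : (haarScalarFactor μ.inv μ : ℝ≥0∞) = 1 := by
    have := (ENNReal.mul_eq_right h0 ht).1 h1.symm
    exact this
  refine ⟨?_⟩
  rw [h, ENNReal.coe_eq_one.1 h3, one_smul]

end Inversion

/-! ### Weil's formula -/

section Fibers

open Measure

variable {G : Type*} [Group G] [TopologicalSpace G] [IsTopologicalGroup G]
    [LocallyCompactSpace G] [T2Space G] [MeasurableSpace G] [BorelSpace G] {H : Subgroup G}

omit [LocallyCompactSpace G] [T2Space G] in
-- Translating by one element h₀ of the left-hand set moves it into K⁻¹K, so the bound is uniform in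
-- x.
theorem measure_coset_preimage_le (ν : Measure H) [ν.IsMulLeftInvariant] (K : Set G) (x : G) :
    ν {h : H | x * h ∈ K} ≤ ν {h : H | (h : G) ∈ K⁻¹ * K} := by
  rcases eq_empty_or_nonempty {h : H | x * h ∈ K} with he | ⟨h₀, hh₀⟩
  · simp [he]
  · rw [← measure_preimage_mul ν h₀⁻¹ {h : H | (h : G) ∈ K⁻¹ * K}]
    refine measure_mono fun h hh => ?_
    refine mem_mul.2 ⟨(x * h₀)⁻¹, Set.inv_mem_inv.2 hh₀, x * h, hh, ?_⟩
    simp [mul_assoc]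

omit [IsTopologicalGroup G] [LocallyCompactSpace G] [T2Space G] [BorelSpace G] in
theorem measure_subgroup_lt_top (ν : Measure H) [IsFiniteMeasureOnCompacts ν]
    (hH : IsClosed (H : Set G)) {K : Set G} (hK : IsCompact K) : ν {h : H | (h : G) ∈ K} < ∞ :=
  (hH.isClosedEmbedding_subtypeVal.isCompact_preimage hK).measure_lt_top

/-- Weil's formula, with the measure on `G ⧸ H` replaced by a measure on `G`. -/
theorem exists_weil_measure [SigmaCompactSpace G] [LocallyCompactSpace H] [SigmaCompactSpace H]
    (μ : Measure G) [μ.IsHaarMeasure] [μ.Regular] (ν : Measure H) [ν.IsHaarMeasure] [ν.Regular]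
    (hH : IsClosed (H : Set G))
    (hmod : ∀ h : H, modularCharacterFun h = modularCharacterFun (h : G)) :
    ∃ κ : Measure G, SFinite κ ∧ ∃ c : ℝ≥0∞, c ≠ 0 ∧ c ≠ ∞ ∧ ∀ E : G → ℝ≥0∞,
      Measurable (fun q : G × H => E (q.1 * q.2)) →
        ∫⁻ x, ∫⁻ h : H, E (x * h) ∂ν ∂κ = c * ∫⁻ x, E x ∂μ := by
  obtain ⟨c, hc0, hc⟩ := exists_lintegral_modular_inv_eq ν
  choose χ hχ1 _ hχs hχ01 using fun n => exists_continuous_one_zero_of_isCompact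
    (isCompact_compactCovering G n) isClosed_empty (disjoint_empty _)
  let N : ℕ → ℝ≥0∞ := fun n => ν {h : H | (h : G) ∈ (tsupport (χ n))⁻¹ * tsupport (χ n)}
  have hN : ∀ n, N n ≠ ∞ := fun n =>
    (measure_subgroup_lt_top ν hH ((hχs n).inv.mul (hχs n))).ne
  -- The weights make β positive everywhere while its fiber integral b stays finite. Since b is
  -- constant on cosets, β / b is a Bruhat function: each fiber integral is 1.
  obtain ⟨a, ha0, ha⟩ := ENNReal.exists_pos_tsum_mul_lt_of_countable one_ne_zero N hN
  let β : G → ℝ≥0∞ := fun x => ∑' n, a n * ENNReal.ofReal (χ n x)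
  let b : G → ℝ≥0∞ := fun x => ∫⁻ h : H, β (x * h) ∂ν
  have hterm : ∀ {Z : Type _} [TopologicalSpace Z] [MeasurableSpace Z] [ContMeas Z] (Φ : Z → G)
      (_ : Continuous Φ) (n : ℕ), Measurable fun z => a n * ENNReal.ofReal (χ n (Φ z)) := by
    intro Z _ _ _ Φ hΦ n
    exact (((χ n).continuous.baireMeas.comp_continuous hΦ).ennreal_ofReal).const_mul _
  have hβm : ∀ {Z : Type _} [TopologicalSpace Z] [MeasurableSpace Z] [ContMeas Z] (Φ : Z → G)
      (_ : Continuous Φ), Measurable fun z => β (Φ z) := by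
    intro Z _ _ _ Φ hΦ
    exact Measurable.tsum fun n => hterm Φ hΦ n
  have hβH : Measurable fun q : G × H => β (q.1 * q.2) := hβm _ (by fun_prop)
  have hbm : Measurable b := hβH.lintegral_prod_right'
  have hχH : ∀ n x, HasCompactSupport fun h : H => χ n (x * h) := fun n x =>
    (hχs n).comp_isClosedEmbedding
      ((Homeomorph.mulLeft x).isClosedEmbedding.comp hH.isClosedEmbedding_subtypeVal)
  have hχle : ∀ n x, ∫⁻ h : H, ENNReal.ofReal (χ n (x * h)) ∂ν ≤ N n := fun n x => by
    have hms : MeasurableSet {h : H | x * h ∈ tsupport (χ n)} :=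
      ((isClosed_tsupport (χ n)).preimage (by fun_prop : Continuous fun h : H => x * h)).measurableSet
    refine le_trans ?_ (measure_coset_preimage_le ν (tsupport (χ n)) x)
    rw [← lintegral_indicator_one hms]
    refine lintegral_mono fun h => ?_
    by_cases hh : x * h ∈ tsupport (χ n)
    · rw [indicator_of_mem (by exact hh)]
      exact ENNReal.ofReal_le_one.2 (hχ01 n _).2
    · rw [image_eq_zero_of_notMem_tsupport hh]; simp
  have hbsum : ∀ x, b x = ∑' n, a n * ∫⁻ h : H, ENNReal.ofReal (χ n (x * h)) ∂ν := fun x => by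
    have h1 : b x = ∑' n, ∫⁻ h : H, a n * ENNReal.ofReal (χ n (x * h)) ∂ν :=
      lintegral_tsum fun n => (hterm (fun h : H => x * h) (by fun_prop) n).aemeasurable
    rw [h1]
    exact tsum_congr fun n => lintegral_const_mul' _ _ ENNReal.coe_ne_top
  have hbt : ∀ x, b x ≠ ∞ := fun x => by
    refine ne_top_of_le_ne_top (ha.trans_le le_top).ne ?_
    rw [hbsum]
    refine ENNReal.tsum_le_tsum fun n => ?_
    rw [mul_comm]
    gcongr
    exact hχle n x
  have hb0 : ∀ x, b x ≠ 0 := fun x => by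
    obtain ⟨n, hn⟩ := exists_mem_compactCovering x
    rw [hbsum]
    intro h0
    have h1 := (ENNReal.tsum_eq_zero.1 h0) n
    rcases mul_eq_zero.1 h1 with h1 | h1
    · exact (ha0 n).ne' (ENNReal.coe_eq_zero.1 h1)
    · have hcont : Continuous fun h : H => χ n (x * h) := by fun_prop
      rw [lintegral_eq_zero_iff hcont.measurable.ennreal_ofReal] at h1
      have hopen : IsOpen {h : H | 0 < χ n (x * h)} := isOpen_lt continuous_const hcont
      refine hopen.measure_ne_zero ν ⟨1, by simp [hχ1 n hn]⟩ ?_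
      refine measure_mono_null (fun h hh => ?_) (ae_iff.1 h1)
      simpa using hh
  have hbinv : ∀ x (h : H), b (x * h) = b x := fun x h => by
    change ∫⁻ k : H, β (x * h * k) ∂ν = ∫⁻ k : H, β (x * k) ∂ν
    rw [← lintegral_mul_left_eq_self (fun k : H => β (x * k)) h]
    simp [mul_assoc]
  -- Inversion on the fiber, used after the substitution x = yh⁻¹ below has produced the modular
  -- factor of G, which `hmod` turns into that of H.
  have hinvb : ∀ y, ∫⁻ h : H, modularCharacterFun h * β (y * (h : G)⁻¹) ∂ν = c * b y := fun y => by
    rw [hbsum, ← ENNReal.tsum_mul_left]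
    have hδm : Measurable fun h : H => (modularCharacterFun h : ℝ≥0∞) :=
      (ENNReal.continuous_coe.comp (continuous_modularCharacterFun ν)).measurable
    simp only [β, ← ENNReal.tsum_mul_left]
    rw [lintegral_tsum fun n => ?_]
    · refine tsum_congr fun n => ?_
      have h1 := hc (fun h : H => χ n (y * h)) (by fun_prop) (hχH n y) fun h => (hχ01 n _).1
      rw [mul_left_comm, ← h1, ← lintegral_const_mul' _ _ ENNReal.coe_ne_top]
      refine lintegral_congr fun h => ?_
      rw [mul_left_comm]
      rfl
    · exact (hδm.mul (hterm (fun h : H => y * (h : G)⁻¹) (by fun_prop) n)).aemeasurable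
  have hβ1 : Measurable β := hβm id continuous_id
  refine ⟨μ.withDensity fun x => β x / b x, inferInstance, c, by simpa using hc0,
    ENNReal.coe_ne_top, fun E hE => ?_⟩
  have hE1 : Measurable E := by
    have : Measurable fun x : G => E ((x, (1 : H)).1 * (x, (1 : H)).2) :=
      hE.comp (by fun_prop : Measurable fun x : G => (x, (1 : H)))
    simpa using this
  refine (lintegral_withDensity_eq_lintegral_mul μ (hβ1.div hbm) hE.lintegral_prod_right').trans ?_
  let E' : G → ℝ≥0∞ := fun x => E x / b x
  have hE' : Measurable fun q : G × H => E' (q.1 * q.2) := by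
    simp only [E', hbinv]
    exact hE.div (hbm.comp measurable_fst)
  have hE'1 : Measurable E' := hE1.div hbm
  calc ∫⁻ x, (β / b * fun x => ∫⁻ h : H, E (x * h) ∂ν) x ∂μ
      = ∫⁻ x, ∫⁻ h : H, β x * E' (x * h) ∂ν ∂μ := by
        refine lintegral_congr fun x => ?_
        have hm : Measurable fun h : H => E (x * h) := hE.comp measurable_prodMk_left
        simp only [E', hbinv, Pi.mul_apply, Pi.inv_apply, div_eq_mul_inv]
        rw [lintegral_const_mul _ (hm.mul_const _), lintegral_mul_const _ hm]
        ring
    _ = ∫⁻ h : H, ∫⁻ x, β x * E' (x * h) ∂μ ∂ν :=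
        lintegral_lintegral_swap (f := fun x (h : H) => β x * E' (x * h))
          ((hβ1.comp measurable_fst).mul hE').aemeasurable
    _ = ∫⁻ h : H, ∫⁻ y, modularCharacterFun h * β (y * (h : G)⁻¹) * E' y ∂μ ∂ν := by
        refine lintegral_congr fun h => ?_
        have h1 := lintegral_mul_right_eq μ (fun y => β (y * (h : G)⁻¹) * E' y) (h : G)
        simp only [mul_inv_cancel_right] at h1
        rw [h1, hmod, ← lintegral_const_mul' _ _ ENNReal.coe_ne_top]
        simp only [mul_assoc]
    _ = ∫⁻ y, ∫⁻ h : H, modularCharacterFun h * β (y * (h : G)⁻¹) * E' y ∂ν ∂μ := by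
        refine lintegral_lintegral_swap
          (f := fun (h : H) y => modularCharacterFun h * β (y * (h : G)⁻¹) * E' y) ?_
        refine Measurable.aemeasurable ?_
        refine Measurable.mul (Measurable.mul ?_ ?_) (hE'1.comp measurable_snd)
        · exact ((ENNReal.continuous_coe.comp (continuous_modularCharacterFun ν)).measurable).comp
            measurable_fst
        · exact hβm (fun q : H × G => q.2 * (q.1 : G)⁻¹) (by fun_prop)
    _ = ∫⁻ y, c * E y ∂μ := by
        refine lintegral_congr fun y => ?_
        rw [lintegral_mul_const, hinvb]
        · simp only [E']
          rw [mul_assoc, ENNReal.mul_div_cancel (hb0 y) (hbt y)]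
        · exact ((ENNReal.continuous_coe.comp (continuous_modularCharacterFun ν)).measurable).mul
            (hβm (fun h : H => y * (h : G)⁻¹) (by fun_prop))
    _ = c * ∫⁻ y, E y ∂μ := lintegral_const_mul _ hE1

end Fibers

/-! ### Choosing a good coset -/

section Selection

variable {G : Type*} [Group G] [TopologicalSpace G] [IsTopologicalGroup G]
    [LocallyCompactSpace G] [T2Space G] [MeasurableSpace G] [BorelSpace G] {H : Subgroup G}
    {μ κ : Measure G} {ν : Measure H} [SFinite ν] {c : ℝ≥0∞}

omit [TopologicalSpace G] [IsTopologicalGroup G] [BorelSpace G] [LocallyCompactSpace G] [T2Space G] in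
-- If the inequality failed on every fiber where the norm of F is finite and nonzero, integrating
-- its p-th power over κ would give A·cB > B·cA.
theorem exists_fiber_eLpNorm_le_of_ne_top (hc0 : c ≠ 0) (hct : c ≠ ∞)
    (hκ : ∀ E : G → ℝ≥0∞, Measurable (fun q : G × H => E (q.1 * q.2)) →
      ∫⁻ x, ∫⁻ h : H, E (x * h) ∂ν ∂κ = c * ∫⁻ x, E x ∂μ)
    {p : ℝ≥0∞} (hp : 1 ≤ p) (hpt : p ≠ ∞) {F Γ : G → ℝ≥0∞}
    (hF : Measurable fun q : G × H => F (q.1 * q.2))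
    (hΓ : Measurable fun q : G × H => Γ (q.1 * q.2))
    (h0 : eLpNorm F p μ ≠ 0) (ht : eLpNorm F p μ ≠ ∞) :
    ∃ x : G, eLpNorm (fun h : H => F (x * h)) p ν ≠ 0 ∧ eLpNorm (fun h : H => F (x * h)) p ν ≠ ∞ ∧
      eLpNorm F p μ * eLpNorm (fun h : H => Γ (x * h)) p ν
        ≤ eLpNorm Γ p μ * eLpNorm (fun h : H => F (x * h)) p ν := by
  have hp0 : p ≠ 0 := (zero_lt_one.trans_le hp).ne'
  have hr0 : 0 < p.toReal := ENNReal.toReal_pos hp0 hpt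
  have hinv : 0 < p.toReal⁻¹ := inv_pos.2 hr0
  simp only [eLpNorm_eq_lintegral_rpow_enorm_toReal hp0 hpt, enorm_eq_self, one_div,
    ← ENNReal.mul_rpow_of_nonneg _ _ hinv.le, ENNReal.rpow_le_rpow_iff hinv, ne_eq,
    ENNReal.rpow_eq_zero_iff_of_pos hinv, ENNReal.rpow_eq_top_iff_of_pos hinv] at h0 ht ⊢
  set A := ∫⁻ x, F x ^ p.toReal ∂μ
  set B := ∫⁻ x, Γ x ^ p.toReal ∂μ
  let φ : G → ℝ≥0∞ := fun x => ∫⁻ h : H, F (x * h) ^ p.toReal ∂ν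
  let γ : G → ℝ≥0∞ := fun x => ∫⁻ h : H, Γ (x * h) ^ p.toReal ∂ν
  have hφm : Measurable φ := (hF.pow_const _).lintegral_prod_right'
  have hγm : Measurable γ := (hΓ.pow_const _).lintegral_prod_right'
  have hφ : ∫⁻ x, φ x ∂κ = c * A := hκ (fun x => F x ^ p.toReal) (hF.pow_const _)
  have hγ : ∫⁻ x, γ x ∂κ = c * B := hκ (fun x => Γ x ^ p.toReal) (hΓ.pow_const _)
  have hfin : ∀ᵐ x ∂κ, φ x < ∞ :=
    ae_lt_top hφm (by rw [hφ]; exact ENNReal.mul_ne_top hct ht)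
  have hne : ∃ᵐ x ∂κ, φ x ≠ 0 := by
    intro h
    have h1 : φ =ᵐ[κ] 0 := by
      filter_upwards [h] with x hx using not_not.1 hx
    rw [← lintegral_eq_zero_iff hφm, hφ] at h1
    exact (mul_ne_zero hc0 h0) h1
  change ∃ x, ¬ φ x = 0 ∧ ¬ φ x = ∞ ∧ A * γ x ≤ B * φ x
  by_contra! hcon
  by_cases hB : B = ∞
  · obtain ⟨x, hx0, hx⟩ := (hne.and_eventually hfin).exists
    have := hcon x hx0 hx.ne
    rw [hB, ENNReal.top_mul hx0] at this
    exact not_top_lt this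
  · have hle : (fun x => B * φ x) ≤ᵐ[κ] fun x => A * γ x := by
      filter_upwards [hfin] with x hx
      by_cases hx0 : φ x = 0
      · simp [hx0]
      · exact (hcon x hx0 hx.ne).le
    have hlt := lintegral_strict_mono_of_ae_le_of_frequently_ae_lt (hγm.const_mul A).aemeasurable
      (by
        rw [lintegral_const_mul _ hφm, hφ]
        exact ENNReal.mul_ne_top hB (ENNReal.mul_ne_top hct ht)) hle
      ((hne.and_eventually hfin).mono fun x hx => (hcon x hx.1 hx.2.ne).ne)
    rw [lintegral_const_mul _ hφm, lintegral_const_mul _ hγm, hφ, hγ] at hlt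
    refine hlt.ne ?_
    ring

omit [TopologicalSpace G] [IsTopologicalGroup G] [BorelSpace G] [LocallyCompactSpace G] [T2Space G] in
-- Almost every fiber obeys the global essential bounds, and the set {F > ‖F‖/2} is seen by a
-- non-null set of fibers. The factor 2 comes from this half, as the supremum need not be attained.
theorem exists_fiber_eLpNorm_top_le (hc0 : c ≠ 0)
    (hκ : ∀ E : G → ℝ≥0∞, Measurable (fun q : G × H => E (q.1 * q.2)) →
      ∫⁻ x, ∫⁻ h : H, E (x * h) ∂ν ∂κ = c * ∫⁻ x, E x ∂μ)
    {F Γ : G → ℝ≥0∞} (hF : Measurable fun q : G × H => F (q.1 * q.2))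
    (hΓ : Measurable fun q : G × H => Γ (q.1 * q.2))
    (h0 : eLpNorm F ∞ μ ≠ 0) (ht : eLpNorm F ∞ μ ≠ ∞) :
    ∃ x : G, eLpNorm (fun h : H => F (x * h)) ∞ ν ≠ 0 ∧ eLpNorm (fun h : H => F (x * h)) ∞ ν ≠ ∞ ∧
      eLpNorm F ∞ μ * eLpNorm (fun h : H => Γ (x * h)) ∞ ν
        ≤ 2 * eLpNorm Γ ∞ μ * eLpNorm (fun h : H => F (x * h)) ∞ ν := by
  have key : ∀ E : Set G, MeasurableSet {q : G × H | q.1 * q.2 ∈ E} →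
      ∫⁻ x, ν {h : H | x * h ∈ E} ∂κ = c * μ E := fun E hE => by
    have hEm : MeasurableSet E := by
      have h1 := (by fun_prop : Measurable fun x : G => (x, (1 : H))) hE
      simpa [preimage] using h1
    have h2 : (fun q : G × H => E.indicator (1 : G → ℝ≥0∞) (q.1 * q.2)) =
        {q : G × H | q.1 * q.2 ∈ E}.indicator 1 := by
      ext q; simp [indicator]
    have h1 := hκ (E.indicator 1) (by rw [h2]; exact measurable_one.indicator hE)
    rw [lintegral_indicator_one hEm] at h1
    rw [← h1]
    refine lintegral_congr fun x => ?_
    have hx : MeasurableSet {h : H | x * h ∈ E} := measurable_prodMk_left hE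
    rw [← lintegral_indicator_one hx]
    refine lintegral_congr fun h => ?_
    simp [indicator]
  simp only [eLpNorm_exponent_top, eLpNormEssSup, enorm_eq_self] at h0 ht ⊢
  set a := essSup F μ
  set b := essSup Γ μ
  have ha2 : a / 2 < a := ENNReal.half_lt_self h0 ht
  have hmid : ∀ (E : Set G), MeasurableSet {q : G × H | q.1 * q.2 ∈ E} → μ E = 0 →
      ∀ᵐ (x : G) ∂κ, ν {h : H | x * h ∈ E} = 0 := fun E hE h => by
    have h1 := key E hE
    rw [h, mul_zero] at h1
    exact (lintegral_eq_zero_iff (f := fun x : G => ν {h : H | x * h ∈ E})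
      (measurable_measure_prodMk_left hE)).1 h1
  have hFa := hmid {x | a < F x} (hF measurableSet_Ioi) (by
    simpa [ae_iff] using ae_le_essSup (f := F) (μ := μ))
  have hΓb := hmid {x | b < Γ x} (hΓ measurableSet_Ioi) (by
    simpa [ae_iff] using ae_le_essSup (f := Γ) (μ := μ))
  have hbig : ∃ᵐ (x : G) ∂κ, ν {h : H | x * h ∈ {x | a / 2 < F x}} ≠ 0 := by
    intro h
    have hm : MeasurableSet {q : G × H | q.1 * q.2 ∈ {x | a / 2 < F x}} := hF measurableSet_Ioi
    have h1 := key {x | a / 2 < F x} hm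
    rw [(lintegral_eq_zero_iff (f := fun x : G => ν {h : H | x * h ∈ {x | a / 2 < F x}})
      (measurable_measure_prodMk_left hm)).2
      (by filter_upwards [h] with x hx using not_not.1 hx)] at h1
    have h2 : μ {x | a / 2 < F x} = 0 := (mul_eq_zero.1 h1.symm).resolve_left hc0
    have h3 : a ≤ a / 2 := essSup_le_of_ae_le _ (by
      rw [EventuallyLE, ae_iff]; simpa using h2)
    exact absurd h3 (not_le.2 ha2)
  obtain ⟨x, hx1, hx2, hx3⟩ := (hbig.and_eventually (hFa.and hΓb)).exists
  have hFx : essSup (fun h : H => F (x * h)) ν ≤ a := essSup_le_of_ae_le _ (by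
    rw [EventuallyLE, ae_iff]; simpa using hx2)
  have hΓx : essSup (fun h : H => Γ (x * h)) ν ≤ b := essSup_le_of_ae_le _ (by
    rw [EventuallyLE, ae_iff]; simpa using hx3)
  have hlow : a / 2 < essSup (fun h : H => F (x * h)) ν := by
    by_contra! hle
    refine hx1 ?_
    have := (ae_le_essSup (f := fun h : H => F (x * h)) (μ := ν)).mono
      fun h hh => hh.trans hle
    simpa [ae_iff] using this
  refine ⟨x, (zero_le.trans_lt hlow).ne', ne_top_of_le_ne_top ht hFx, ?_⟩
  calc a * essSup (fun h : H => Γ (x * h)) ν ≤ a * b := by gcongr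
    _ = 2 * b * (a / 2) := by
        rw [mul_comm 2 b, mul_assoc, ENNReal.mul_div_cancel two_ne_zero ENNReal.ofNat_ne_top,
          mul_comm]
    _ ≤ _ := by gcongr

omit [TopologicalSpace G] [IsTopologicalGroup G] [BorelSpace G] [LocallyCompactSpace G] [T2Space G] in
/-- Some fiber of `F` is nontrivial and has at most twice the average ratio of norms. -/
theorem exists_fiber_eLpNorm_le (hc0 : c ≠ 0) (hct : c ≠ ∞)
    (hκ : ∀ E : G → ℝ≥0∞, Measurable (fun q : G × H => E (q.1 * q.2)) →
      ∫⁻ x, ∫⁻ h : H, E (x * h) ∂ν ∂κ = c * ∫⁻ x, E x ∂μ)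
    {p : ℝ≥0∞} (hp : 1 ≤ p) {F Γ : G → ℝ≥0∞}
    (hF : Measurable fun q : G × H => F (q.1 * q.2))
    (hΓ : Measurable fun q : G × H => Γ (q.1 * q.2))
    (h0 : eLpNorm F p μ ≠ 0) (ht : eLpNorm F p μ ≠ ∞) :
    ∃ x : G, eLpNorm (fun h : H => F (x * h)) p ν ≠ 0 ∧ eLpNorm (fun h : H => F (x * h)) p ν ≠ ∞ ∧
      eLpNorm F p μ * eLpNorm (fun h : H => Γ (x * h)) p ν
        ≤ 2 * eLpNorm Γ p μ * eLpNorm (fun h : H => F (x * h)) p ν := by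
  rcases eq_or_ne p ∞ with rfl | hpt
  · exact exists_fiber_eLpNorm_top_le hc0 hκ hF hΓ h0 ht
  · obtain ⟨x, h1, h2, h3⟩ := exists_fiber_eLpNorm_le_of_ne_top hc0 hct hκ hp hpt hF hΓ h0 ht
    refine ⟨x, h1, h2, h3.trans ?_⟩
    gcongr
    rw [two_mul]
    exact le_self_add

end Selection

/-- The cross-multiplied form permits zero denominators: N' = 0 makes the right side infinite, and N
= 0 forces N' = 0. -/
theorem ENNReal.div_le_mul_div {A B N N' K : ℝ≥0∞} (hA : A ≠ 0) (hB0 : B ≠ 0) (hB : B ≠ ∞)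
    (hN : N ≠ ∞) (hK0 : K ≠ 0) (hK : K ≠ ∞) (h : A * N' ≤ K * N * B) :
    A / N ≤ K * (B / N') := by
  by_cases hN' : N' = 0
  · rw [hN', ENNReal.div_zero hB0, ENNReal.mul_top hK0]
    exact le_top
  have hN't : N' ≠ ∞ := by
    rintro rfl
    rw [ENNReal.mul_top hA, top_le_iff] at h
    exact ENNReal.mul_ne_top (ENNReal.mul_ne_top hK hN) hB h
  have hN0 : N ≠ 0 := by
    rintro rfl
    rw [mul_zero, zero_mul] at h
    exact (mul_ne_zero hA hN') (le_antisymm h zero_le)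
  rw [ENNReal.div_le_iff hN0 hN, ← mul_div_assoc, mul_comm, ← mul_div_assoc,
    ENNReal.le_div_iff_mul_le (.inl hN') (.inl hN't)]
  calc A * N' ≤ K * N * B := h
    _ = _ := by ring

/-! ### Measure of the support on a coset -/

section Core

variable {G : Type*} [Group G] [TopologicalSpace G] [IsTopologicalGroup G]
    [LocallyCompactSpace G] [T2Space G] [SigmaCompactSpace G] [MeasurableSpace G] [BorelSpace G]
    {H : Subgroup G} [LocallyCompactSpace H] [SigmaCompactSpace H]
    {μ : Measure G} [μ.IsHaarMeasure] [μ.Regular]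
    {ν : Measure H} [ν.IsHaarMeasure] [ν.Regular]

omit [T2Space G] [SigmaCompactSpace G] [BorelSpace G] [MeasurableSpace G] in
/-- There is a compact neighborhood of `1` which is a Baire set. -/
theorem exists_compact_baire_nhds_one : ∃ U : Set G, IsCompact U ∧ U ∈ nhds (1 : G) ∧
    ∃ χ : C(G, ℝ), U = {x | 1 / 2 ≤ χ x} := by
  obtain ⟨χ, hχ1, -, hχs, -⟩ := exists_continuous_one_zero_of_isCompact
    (isCompact_singleton (x := (1 : G))) isClosed_empty (disjoint_empty _)
  have h1 : χ 1 = 1 := hχ1 rfl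
  refine ⟨{x | 1 / 2 ≤ χ x}, ?_, ?_, χ, rfl⟩
  · refine IsCompact.of_isClosed_subset hχs (isClosed_le continuous_const χ.continuous)
      fun x hx => subset_tsupport _ ?_
    have : (1 / 2 : ℝ) ≤ χ x := hx
    exact ne_of_gt (by linarith)
  · exact mem_of_superset ((isOpen_lt continuous_const χ.continuous).mem_nhds
      (show (1 / 2 : ℝ) < χ 1 by rw [h1]; norm_num)) fun x (hx : 1 / 2 < χ x) => show 1 / 2 ≤ χ x from hx.le

omit [LocallyCompactSpace H] [μ.Regular] [ν.Regular] in
/-- The fibers of the region where the trimmed average is nonzero have controlled measure. -/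
theorem measure_fiber_le {U : Set G} (hU : IsCompact U) (hU1 : U ∈ nhds (1 : G)) {χ : C(G, ℝ)}
    (hχ : U = {x | 1 / 2 ≤ χ x}) {g : G → ℝ} (hg : BaireMeas g) (x : G) :
    ν {h : H | trimmedAvg μ U g (x * h) ≠ 0} ≤
      2 / μ U * ν {h : H | (h : G) ∈ U * U⁻¹} * μ {y | g y ≠ 0} := by
  have hm0 : μ U ≠ 0 := (Measure.measure_pos_of_mem_nhds μ hU1).ne'
  have hmt : μ U ≠ ∞ := hU.measure_lt_top.ne
  have hgm : Measurable g := hg.measurable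
  let A : Set G := {y | g y ≠ 0}
  let B : Set H := {h : H | trimmedAvg μ U g (x * h) ≠ 0}
  have hUH : MeasurableSet {q : H × G | (q.1 : G)⁻¹ * q.2 ∈ U} := by
    have h1 : Measurable fun q : H × G => χ ((q.1 : G)⁻¹ * q.2) :=
      χ.continuous.baireMeas.comp_continuous (by fun_prop)
    rw [hχ]
    exact h1 measurableSet_Ici
  have hA : MeasurableSet A := hgm (measurableSet_singleton 0).compl
  have hxA : MeasurableSet {y | x * y ∈ A} := measurable_const_mul x hA
  have hB : MeasurableSet B :=
    ((hg.trimmedAvg U).comp_continuous (by fun_prop : Continuous fun h : H => x * (h : G)))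
      (measurableSet_singleton 0).compl
  -- Double counting of pairs (h, y) with h⁻¹y ∈ U and xy ∈ A: each h ∈ B has at least μ U / 2
  -- partners y, while each y has at most ν(H ∩ UU⁻¹) partners h. U is the superlevel set of a
  -- continuous function so that this relation is measurable in the product.
  have step1 : ∀ h ∈ B, μ U ≤ 2 * ∫⁻ y, {y | x * y ∈ A}.indicator 1 y *
      {q : H × G | (q.1 : G)⁻¹ * q.2 ∈ U}.indicator 1 (h, y) ∂μ := fun h hh => by
    refine (measure_le_of_trimmedAvg_ne_zero hgm hU.measurableSet hm0 hmt hh).trans ?_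
    gcongr
    have hM : MeasurableSet ((fun y => (h : G)⁻¹ * y) ⁻¹' (U ∩ {u | g (x * h * u) ≠ 0})) :=
      measurable_const_mul _ (hU.measurableSet.inter
        ((hgm.comp (measurable_const_mul _)) (measurableSet_singleton 0).compl))
    rw [← measure_preimage_mul μ (h : G)⁻¹, ← lintegral_indicator_one hM]
    refine lintegral_mono fun y => ?_
    by_cases h1 : (h : G)⁻¹ * y ∈ U
    · by_cases h2 : g (x * y) = 0
      · simp [h1, h2, A, indicator, mul_assoc]
      · simp [h1, h2, A, indicator, mul_assoc]
    · simp [h1, indicator]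
  have hmu : ν B * μ U ≤ 2 * (ν {h : H | (h : G) ∈ U * U⁻¹} * μ A) := by
    calc ν B * μ U = ∫⁻ _ in B, μ U ∂ν := by rw [setLIntegral_const, mul_comm]
      _ ≤ ∫⁻ h in B, 2 * ∫⁻ y, {y | x * y ∈ A}.indicator 1 y *
            {q : H × G | (q.1 : G)⁻¹ * q.2 ∈ U}.indicator 1 (h, y) ∂μ ∂ν :=
          setLIntegral_mono' hB step1
      _ ≤ ∫⁻ h, 2 * ∫⁻ y, {y | x * y ∈ A}.indicator 1 y *
            {q : H × G | (q.1 : G)⁻¹ * q.2 ∈ U}.indicator 1 (h, y) ∂μ ∂ν :=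
          setLIntegral_le_lintegral _ _
      _ = 2 * ∫⁻ y, ∫⁻ h, {y | x * y ∈ A}.indicator 1 y *
            {q : H × G | (q.1 : G)⁻¹ * q.2 ∈ U}.indicator 1 (h, y) ∂ν ∂μ := by
          rw [lintegral_const_mul' _ _ ENNReal.ofNat_ne_top]
          congr 1
          refine lintegral_lintegral_swap (f := fun h y => {y | x * y ∈ A}.indicator 1 y *
            {q : H × G | (q.1 : G)⁻¹ * q.2 ∈ U}.indicator (1 : H × G → ℝ≥0∞) (h, y)) ?_
          exact (((measurable_one.indicator hxA).comp measurable_snd).mul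
            (measurable_one.indicator hUH)).aemeasurable
      _ ≤ 2 * ∫⁻ y, {y | x * y ∈ A}.indicator 1 y * ν {h : H | (h : G) ∈ U * U⁻¹} ∂μ := by
          gcongr with y
          have hs : MeasurableSet {h : H | (h : G)⁻¹ * y ∈ U} := measurable_prodMk_right hUH
          have h1 : ∫⁻ h, {y | x * y ∈ A}.indicator (1 : G → ℝ≥0∞) y *
              {q : H × G | (q.1 : G)⁻¹ * q.2 ∈ U}.indicator 1 (h, y) ∂ν =
              {y | x * y ∈ A}.indicator 1 y * ν {h : H | (h : G)⁻¹ * y ∈ U} := by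
            rw [← lintegral_indicator_one hs]
            exact lintegral_const_mul _ (measurable_one.indicator hs)
          rw [h1]
          refine mul_le_mul' le_rfl ?_
          have h2 := measure_coset_preimage_le ν U⁻¹ y⁻¹
          rw [inv_inv] at h2
          refine le_trans (measure_mono fun h hh => ?_) h2
          have : (h : G)⁻¹ * y ∈ U := hh
          simpa using this
      _ = 2 * (ν {h : H | (h : G) ∈ U * U⁻¹} * μ A) := by
          rw [lintegral_mul_const _ (measurable_one.indicator hxA), lintegral_indicator_one hxA,
            mul_comm (ν _)]
          congr 2
          exact measure_preimage_mul μ x A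
  rw [← ENNReal.mul_le_mul_iff_left hm0 hmt]
  refine hmu.trans (le_of_eq ?_)
  rw [mul_right_comm, mul_right_comm (2 / μ U), ENNReal.div_mul_cancel hm0 hmt, mul_assoc]

end Core

/-! ### From a function on G to a function on H -/

section Core

variable {G : Type*} [Group G] [TopologicalSpace G] [IsTopologicalGroup G]
    [LocallyCompactSpace G] [T2Space G] [MeasurableSpace G] [BorelSpace G]
    {H : Subgroup G} {μ : Measure G} [μ.IsHaarMeasure] [μ.Regular]
    [LocallyCompactSpace H] {ν : Measure H} [ν.IsHaarMeasure] [ν.Regular]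

theorem enorm_toReal_sub_toReal_le {a b e : ℝ≥0∞} (ha : a ≠ ∞) (hb : b ≠ ∞) (hab : a ≤ b + e)
    (hba : b ≤ a + e) : ‖a.toReal - b.toReal‖ₑ ≤ e := by
  rcases eq_or_ne e ∞ with rfl | he
  · exact le_top
  have h1 := ENNReal.toReal_mono (ENNReal.add_ne_top.2 ⟨hb, he⟩) hab
  have h2 := ENNReal.toReal_mono (ENNReal.add_ne_top.2 ⟨ha, he⟩) hba
  rw [ENNReal.toReal_add hb he] at h1
  rw [ENNReal.toReal_add ha he] at h2
  rw [← ofReal_norm, Real.norm_eq_abs]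
  refine ENNReal.ofReal_le_of_le_toReal (abs_le.2 ⟨by linarith, by linarith⟩)

/-- The main step: a function on `G` of small translation norm has a regularization whose
restriction to some coset of `H` has a comparably small gradient. -/
theorem exists_fiber_function {S : Set G} (hS : IsCompactSymmGen S) (hH : IsClosed (H : Set G))
    {T : Set H} (hT : IsCompactSymmGen T)
    (hmod : ∀ h : H, Measure.modularCharacterFun h = Measure.modularCharacterFun (h : G))
    {p : ℝ≥0∞} (hp : 1 ≤ p) :
    ∃ K : ℝ≥0, K ≠ 0 ∧ ∃ D : Set G, IsCompact D ∧ ∀ f : G → ℝ, MemLp f p μ →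
      eLpNorm f p μ ≤ K * rightTransNorm S μ p f ∨
      ∃ f' : H → ℝ, Measurable f' ∧ MemLp f' p ν ∧
        (∃ x : G, ∀ h ∈ Function.support f', ∃ u ∈ D, x * h * u ∈ Function.support f) ∧
        (∀ A : Set G, Function.support f ⊆ A → ν (Function.support f') ≤ K * μ A) ∧
        eLpNorm f p μ / rightTransNorm S μ p f
          ≤ K * (eLpNorm f' p ν / rightGradNorm T ν p f') := by
  have := hS.sigmaCompactSpace
  have := hT.sigmaCompactSpace
  obtain ⟨κ, hκs, w, hw0, hwt, hκ⟩ := exists_weil_measure μ ν hH hmod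
  obtain ⟨U, hU, hU1, χ, hχ⟩ := exists_compact_baire_nhds_one (G := G)
  let T' : Set G := (fun t : H => (t : G)) '' T
  let V : Set G := U ∪ T' * U
  have hV : IsCompact V := hU.union ((hT.isCompact.image continuous_subtype_val).mul hU)
  have hUV : U ⊆ V := subset_union_left
  have htV : ∀ t ∈ T, (t : G) • U ⊆ V := fun t ht => by
    rintro _ ⟨u, hu, rfl⟩
    exact Or.inr (mul_mem_mul (mem_image_of_mem _ ht) hu)
  obtain ⟨c, hc⟩ := hS.exists_eLpNorm_translate_sub_le (μ := μ) hp hV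
  have hm0 : μ U ≠ 0 := (Measure.measure_pos_of_mem_nhds μ hU1).ne'
  have hmt : μ U ≠ ∞ := hU.measure_lt_top.ne
  have hVt : μ V ≠ ∞ := hV.measure_lt_top.ne
  have hfib : ν {h : H | (h : G) ∈ U * U⁻¹} ≠ ∞ :=
    (measure_subgroup_lt_top ν hH (hU.mul hU.inv)).ne
  lift μ U to ℝ≥0 using hmt with mU hmU
  lift μ V to ℝ≥0 using hVt with mV hmV
  lift ν {h : H | (h : G) ∈ U * U⁻¹} to ℝ≥0 using hfib with cH hcH
  have hmU0 : mU ≠ 0 := by simpa using hm0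
  have hdiv : ∀ n : ℝ≥0, (n : ℝ≥0∞) / mU = ((n / mU : ℝ≥0) : ℝ≥0∞) := fun n =>
    (ENNReal.coe_div hmU0).symm
  have hd2 : (2 : ℝ≥0∞) / mU = ((2 / mU : ℝ≥0) : ℝ≥0∞) := hdiv 2
  have hd3 : (3 : ℝ≥0∞) / mU = ((3 / mU : ℝ≥0) : ℝ≥0∞) := hdiv 3
  -- C₁ bounds ‖Γ‖ / N, C₂ the total loss of regularization, and C₃ combines the lower bound on F,
  -- the gradient bound 3 / mU and the choice of the coset.
  let C₁ : ℝ≥0 := mV * (mV * (c + c))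
  let C₂ : ℝ≥0 := 2 / mU * C₁ + mU * c + 1
  let C₃ : ℝ≥0 := 2 / mU * (3 / mU) * (2 * C₁) + 1
  let K : ℝ≥0 := 2 / mU * C₂ + 2 / mU * cH + C₃
  refine ⟨K, by positivity, U, hU, fun f hf => ?_⟩
  obtain ⟨g, hg, hfg⟩ := hf.exists_baireMeas hp
  have hgp : MemLp g p μ := hf.ae_eq hfg
  have hgm : Measurable g := hg.measurable
  have hnorm : eLpNorm f p μ = eLpNorm g p μ := eLpNorm_congr_ae hfg
  have hN : rightTransNorm S μ p f = rightTransNorm S μ p g := rightTransNorm_congr_ae μ hfg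
  set N := rightTransNorm S μ p f
  have hcL : ∀ u ∈ V, eLpNorm (fun x => g (x * u) - g x) p μ ≤ c * N := fun u hu => by
    rw [hN]; exact hc g hgm u hu
  let F := trimmedAvg μ U g
  let Γ := oscOn μ V g
  have hFm : Measurable F := (hg.trimmedAvg U).measurable
  have hΓm : Measurable Γ := (hg.oscOn V).measurable
  have hΓ : eLpNorm Γ p μ ≤ C₁ * N := by
    refine (eLpNorm_oscOn_le hp hg hV.measurableSet hV.measure_lt_top.ne hcL).trans (le_of_eq ?_)
    rw [← hmV]
    simp only [C₁]
    push_cast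
    ring
  have hD : eLpNorm (fun x => ∫⁻ u in U, ‖g (x * u) - g x‖ₑ ∂μ) p μ ≤ mU * (c * N) := by
    rw [hmU]
    exact eLpNorm_setLIntegral_translate_sub_le hp hg hU.measurableSet hU.measure_lt_top.ne
      fun u hu => hcL u (hUV hu)
  have hDm : Measurable fun x => ∫⁻ u in U, ‖g (x * u) - g x‖ₑ ∂μ := by
    refine Measurable.lintegral_prod_right' (f := fun q : G × G => ‖g (q.1 * q.2) - g q.1‖ₑ) ?_
    exact ((hg.comp_continuous continuous_mul).sub (hg.comp_continuous continuous_fst)).enorm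
  have hscale : eLpNorm ((mU : ℝ) • g) p μ = mU * eLpNorm g p μ := by
    rw [eLpNorm_const_smul, Real.enorm_of_nonneg mU.coe_nonneg, ENNReal.ofReal_coe_nnreal]
  have hscale' : ∀ x, ‖((mU : ℝ) • g) x‖ₑ = mU * ‖g x‖ₑ := fun x => by
    rw [Pi.smul_apply, enorm_smul, Real.enorm_of_nonneg mU.coe_nonneg, ENNReal.ofReal_coe_nnreal]
  have hlow : mU * eLpNorm g p μ ≤ eLpNorm F p μ + C₂ * N := by
    calc mU * eLpNorm g p μ = eLpNorm ((mU : ℝ) • g) p μ := hscale.symm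
      _ ≤ eLpNorm ((F + fun x => ((2 / mU : ℝ≥0) : ℝ≥0∞) * Γ x) +
            fun x => ∫⁻ u in U, ‖g (x * u) - g x‖ₑ ∂μ) p μ := by
          refine eLpNorm_mono_enorm fun x => ?_
          rw [hscale', hmU]
          refine (measure_mul_enorm_le hgm x).trans ?_
          simp only [Pi.add_apply, enorm_eq_self]
          rw [← hmU, hd2]
          gcongr
          exact oscOn_mono hUV g x
      _ ≤ eLpNorm F p μ + eLpNorm (fun x => ((2 / mU : ℝ≥0) : ℝ≥0∞) * Γ x) p μ +
            eLpNorm (fun x => ∫⁻ u in U, ‖g (x * u) - g x‖ₑ ∂μ) p μ := by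
          refine (eLpNorm_add_le (hFm.add (hΓm.const_mul _)).aestronglyMeasurable
            hDm.aestronglyMeasurable hp).trans ?_
          gcongr
          exact eLpNorm_add_le hFm.aestronglyMeasurable
            (hΓm.const_mul _).aestronglyMeasurable hp
      _ ≤ eLpNorm F p μ + ((2 / mU : ℝ≥0) : ℝ≥0∞) * (C₁ * N) + mU * (c * N) := by
          gcongr
          refine (eLpNorm_le_nnreal_smul_eLpNorm_of_ae_le_mul' (g := Γ) (c := 2 / mU)
            (ae_of_all _ fun x => by simp) p).trans ?_
          rw [ENNReal.smul_def, smul_eq_mul]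
          gcongr
      _ ≤ eLpNorm F p μ + C₂ * N := by
          simp only [C₂]
          push_cast
          rw [add_assoc]
          gcongr
          rw [add_mul, add_mul, mul_assoc, mul_assoc]
          exact le_self_add
  have hFt : N ≠ ∞ → eLpNorm F p μ ≠ ∞ := fun hNt => by
    have h1 : eLpNorm F p μ ≤ eLpNorm ((fun x => ‖((mU : ℝ) • g) x‖ₑ) +
        fun x => ∫⁻ u in U, ‖g (x * u) - g x‖ₑ ∂μ) p μ := by
      refine eLpNorm_mono_enorm fun x => ?_
      simp only [enorm_eq_self, Pi.add_apply]
      rw [hscale', hmU]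
      calc F x ≤ avgOn μ U g x := tsub_le_self
        _ ≤ ∫⁻ u in U, (‖g x‖ₑ + ‖g (x * u) - g x‖ₑ) ∂μ := by
            refine lintegral_mono fun u => ?_
            simpa using enorm_add_le (g x) (g (x * u) - g x)
        _ = _ := by rw [lintegral_add_left measurable_const, setLIntegral_const, mul_comm]
    refine ne_top_of_le_ne_top ?_ (h1.trans (eLpNorm_add_le
      (hgm.const_smul _).enorm.aestronglyMeasurable hDm.aestronglyMeasurable hp))
    rw [eLpNorm_enorm, hscale]
    refine ENNReal.add_ne_top.2 ⟨ENNReal.mul_ne_top ENNReal.coe_ne_top hgp.2.ne, ?_⟩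
    exact ne_top_of_le_ne_top (ENNReal.mul_ne_top ENNReal.coe_ne_top
      (ENNReal.mul_ne_top ENNReal.coe_ne_top hNt)) hD
  -- Either the loss C₂ N is at least half of mU ‖g‖, giving the first alternative, or F keeps at
  -- least half of mU ‖g‖.
  by_cases hcase : mU * eLpNorm g p μ ≤ 2 * C₂ * N
  · left
    have h1 : eLpNorm g p μ ≤ ((2 / mU * C₂ : ℝ≥0) : ℝ≥0∞) * N := by
      rw [← ENNReal.mul_le_mul_iff_right (a := (mU : ℝ≥0∞)) (by simpa using hmU0)
        ENNReal.coe_ne_top]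
      refine hcase.trans (le_of_eq ?_)
      rw [← mul_assoc, ← ENNReal.coe_mul, ← mul_assoc, mul_div_cancel₀ _ hmU0]
      push_cast
      rfl
    rw [hnorm]
    refine h1.trans ?_
    gcongr
    simp only [K]
    rw [add_assoc]
    exact le_self_add
  right
  push Not at hcase
  -- The summand 1 keeps C₂ positive, so an infinite N would have fallen into the first case.
  have hNt : N ≠ ∞ := by
    rintro h
    rw [h, ENNReal.mul_top (by positivity)] at hcase
    exact not_top_lt hcase
  have hFlow : mU * eLpNorm g p μ ≤ 2 * eLpNorm F p μ := by
    have hfin : mU * eLpNorm g p μ ≠ ∞ := ENNReal.mul_ne_top ENNReal.coe_ne_top hgp.2.ne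
    refine ENNReal.le_of_add_le_add_right hfin ?_
    calc mU * eLpNorm g p μ + mU * eLpNorm g p μ = 2 * (mU * eLpNorm g p μ) := (two_mul _).symm
      _ ≤ 2 * (eLpNorm F p μ + C₂ * N) := by gcongr
      _ = 2 * eLpNorm F p μ + 2 * C₂ * N := by ring
      _ ≤ _ := by gcongr
  have hF0 : eLpNorm F p μ ≠ 0 := by
    intro h
    rw [h, mul_zero] at hFlow
    exact (zero_le.trans_lt (hcase.trans_le hFlow)).false
  obtain ⟨x, hx0, hxt, hx⟩ := exists_fiber_eLpNorm_le (F := F) (Γ := Γ) (p := p) hw0 hwt hκ hp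
    ((hg.trimmedAvg U).comp_continuous (by fun_prop))
    ((hg.oscOn V).comp_continuous (by fun_prop)) hF0 (hFt hNt)
  have hFfin : ∀ y, F y ≠ ∞ := fun y => ne_top_of_le_ne_top
    (avgOn_lt_top (hgp.locallyIntegrable hp) hU y).ne tsub_le_self
  let f' : H → ℝ := fun h => (F (x * h)).toReal
  have hf'e : ∀ h, ‖f' h‖ₑ = F (x * h) := fun h => by
    simp only [f']
    rw [Real.enorm_of_nonneg ENNReal.toReal_nonneg, ENNReal.ofReal_toReal (hFfin _)]
  have hf'n : eLpNorm f' p ν = eLpNorm (fun h : H => F (x * h)) p ν := by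
    rw [← eLpNorm_enorm]
    simp only [hf'e]
  have hf'm : Measurable f' :=
    ((hg.trimmedAvg U).comp_continuous
      (by fun_prop : Continuous fun h : H => x * (h : G))).ennreal_toReal
  have hsupp : ∀ h, h ∈ Function.support f' ↔ F (x * h) ≠ 0 := fun h => by
    rw [Function.mem_support, ← hf'e, enorm_ne_zero]
  have hgrad : rightGradNorm T ν p f' ≤
      ((3 / mU : ℝ≥0) : ℝ≥0∞) * eLpNorm (fun h : H => Γ (x * h)) p ν := by
    rw [← smul_eq_mul, ← ENNReal.smul_def]
    refine eLpNorm_le_nnreal_smul_eLpNorm_of_ae_le_mul' (ae_of_all _ fun h => ?_) p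
    rw [enorm_eq_self, enorm_eq_self]
    refine iSup₂_le fun t ht => ?_
    have h1 := trimmedAvg_mul_le (μ := μ) hgm (hmU ▸ hm0) hU.measure_lt_top.ne hUV (htV t ht) (x * h)
    have h2 := trimmedAvg_le_mul (μ := μ) hgm (hmU ▸ hm0) hU.measure_lt_top.ne hUV (htV t ht) (x * h)
    rw [← hmU, hd3] at h1 h2
    refine enorm_toReal_sub_toReal_le (hFfin _) (hFfin _) ?_ ?_
    · rw [Subgroup.coe_mul, ← mul_assoc]; exact h1
    · rw [Subgroup.coe_mul, ← mul_assoc]; exact h2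
  refine ⟨f', hf'm, ⟨hf'm.aestronglyMeasurable, by rw [hf'n]; exact hxt.lt_top⟩, ⟨x, ?_⟩, ?_, ?_⟩
  · intro h hh
    have h1 := measure_le_of_trimmedAvg_ne_zero hgm hU.measurableSet (hmU ▸ hm0)
      hU.measure_lt_top.ne ((hsupp h).1 hh)
    by_contra! hcon
    -- The support statement concerns f and not its representative g: if f vanished on all of xhU,
    -- then g would vanish almost everywhere there, against the half-measure bound.
    have h2 : ∀ᵐ u ∂μ, f (x * h * u) = g (x * h * u) :=
      (measurePreserving_mul_left μ (x * h)).quasiMeasurePreserving.ae hfg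
    have h3 : μ (U ∩ {u | g (x * h * u) ≠ 0}) = 0 := by
      refine measure_mono_null (fun u hu => ?_) (ae_iff.1 h2)
      have h4 : f (x * h * u) = 0 := by simpa using hcon u hu.1
      change ¬ f (x * h * u) = g (x * h * u)
      rw [h4]
      exact fun h5 => hu.2 h5.symm
    rw [h3, mul_zero, ← hmU] at h1
    exact hm0 (le_antisymm h1 zero_le)
  · intro A hA
    have h1 := measure_fiber_le (μ := μ) (ν := ν) hU hU1 hχ hg x
    rw [← hmU, ← hcH, hd2] at h1
    have h2 : μ {y | g y ≠ 0} ≤ μ A := by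
      refine measure_mono_ae ?_
      filter_upwards [hfg] with y hy hgy
      exact hA (show f y ≠ 0 by rw [hy]; exact hgy)
    calc ν (Function.support f') = ν {h : H | trimmedAvg μ U g (x * h) ≠ 0} := by
          congr 1; ext h; exact hsupp h
      _ ≤ _ := h1
      _ ≤ K * μ A := by
          rw [← ENNReal.coe_mul]
          gcongr
          simp only [K]
          rw [add_assoc, add_left_comm]
          exact le_self_add
  · have hg0 : eLpNorm g p μ ≠ 0 := by
      intro h
      rw [h, mul_zero] at hcase
      exact not_lt_zero hcase
    rw [hnorm, hf'n]
    refine ENNReal.div_le_mul_div hg0 hx0 hxt hNt (by simpa using (by positivity : K ≠ 0))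
      ENNReal.coe_ne_top ?_
    rw [← ENNReal.mul_le_mul_iff_right (a := (mU : ℝ≥0∞)) (by simpa using hmU0)
        ENNReal.coe_ne_top]
    calc (mU : ℝ≥0∞) * (eLpNorm g p μ * rightGradNorm T ν p f')
        ≤ mU * (eLpNorm g p μ * (((3 / mU : ℝ≥0) : ℝ≥0∞) *
            eLpNorm (fun h : H => Γ (x * h)) p ν)) := by gcongr
      _ = ((3 / mU : ℝ≥0) : ℝ≥0∞) * ((mU * eLpNorm g p μ) *
            eLpNorm (fun h : H => Γ (x * h)) p ν) := by ring
      _ ≤ ((3 / mU : ℝ≥0) : ℝ≥0∞) * ((2 * eLpNorm F p μ) *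
            eLpNorm (fun h : H => Γ (x * h)) p ν) := by gcongr
      _ = 2 * ((3 / mU : ℝ≥0) : ℝ≥0∞) * (eLpNorm F p μ *
            eLpNorm (fun h : H => Γ (x * h)) p ν) := by ring
      _ ≤ 2 * ((3 / mU : ℝ≥0) : ℝ≥0∞) * (2 * (C₁ * N) *
            eLpNorm (fun h : H => F (x * h)) p ν) := by
          refine mul_le_mul' le_rfl (hx.trans ?_)
          gcongr
      _ = ((mU * (2 / mU * (3 / mU) * (2 * C₁)) : ℝ≥0) : ℝ≥0∞) * N *
            eLpNorm (fun h : H => F (x * h)) p ν := by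
          have h1 : mU * (2 / mU * (3 / mU) * (2 * C₁)) = 2 * (3 / mU) * (2 * C₁) := by
            field_simp
          rw [h1]
          push_cast
          ring
      _ ≤ ((mU * K : ℝ≥0) : ℝ≥0∞) * N * eLpNorm (fun h : H => F (x * h)) p ν := by
          gcongr
          simp only [K, C₃]
          exact le_self_add.trans le_add_self
      _ = _ := by
          push_cast
          ring

end Core

/-! ### Word lengths and balls -/

section WordMetric

variable {G : Type*} [Group G] {S : Set G}

theorem wordDist_one_le {g : G} {n : ℕ} (h : g ∈ S ^ n) : wordDist S 1 g ≤ n :=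
  Nat.sInf_le (by simpa using h)

theorem mem_wordBall {r : ℝ≥0∞} {g : G} :
    g ∈ wordBall S r ↔ (wordDist S 1 g : ℝ≥0∞) ≤ r := Iff.rfl

variable [TopologicalSpace G]

namespace IsCompactSymmGen

theorem mem_pow_wordDist (hS : IsCompactSymmGen S) (g : G) : g ∈ S ^ wordDist S 1 g := by
  have h : {n : ℕ | (1 : G)⁻¹ * g ∈ S ^ n}.Nonempty := by simpa using! hS.exists_mem_pow g
  have h1 : (1 : G)⁻¹ * g ∈ S ^ wordDist S 1 g := Nat.sInf_mem h
  simpa only [inv_one, one_mul] using h1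

theorem wordDist_mul_le (hS : IsCompactSymmGen S) (g h : G) :
    wordDist S 1 (g * h) ≤ wordDist S 1 g + wordDist S 1 h := by
  refine wordDist_one_le ?_
  rw [pow_add]
  exact mul_mem_mul (hS.mem_pow_wordDist g) (hS.mem_pow_wordDist h)

theorem wordDist_inv_le (hS : IsCompactSymmGen S) (g : G) :
    wordDist S 1 g⁻¹ ≤ wordDist S 1 g :=
  wordDist_one_le (hS.inv_mem_pow (hS.mem_pow_wordDist g))

theorem wordDist_inv (hS : IsCompactSymmGen S) (g : G) :
    wordDist S 1 g⁻¹ = wordDist S 1 g :=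
  (hS.wordDist_inv_le g).antisymm (by simpa using hS.wordDist_inv_le g⁻¹)

theorem inv_wordBall (hS : IsCompactSymmGen S) (r : ℝ≥0∞) : (wordBall S r)⁻¹ = wordBall S r := by
  ext g
  simp [wordBall, hS.wordDist_inv]

theorem wordBall_natCast (hS : IsCompactSymmGen S) (n : ℕ) :
    wordBall S n = ⋃ k ∈ Finset.range (n + 1), S ^ k := by
  ext g
  simp only [wordBall, mem_ofPred_eq, Nat.cast_le, mem_iUnion, Finset.mem_range, exists_prop]
  exact ⟨fun h => ⟨_, Nat.lt_succ_of_le h, hS.mem_pow_wordDist g⟩,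
    fun ⟨k, hk, hg⟩ => (wordDist_one_le hg).trans (Nat.le_of_lt_succ hk)⟩

variable [IsTopologicalGroup G]

theorem isCompact_wordBall (hS : IsCompactSymmGen S) (n : ℕ) : IsCompact (wordBall S (n : ℝ≥0∞)) := by
  rw [hS.wordBall_natCast]
  exact (Finset.range (n + 1)).isCompact_biUnion fun k _ => hS.isCompact_pow k

theorem exists_wordDist_le [LocallyCompactSpace G] [T2Space G] (hS : IsCompactSymmGen S)
    {K : Set G} (hK : IsCompact K) : ∃ m : ℕ, ∀ g ∈ K, wordDist S 1 g ≤ m := by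
  obtain ⟨m, hm⟩ := hS.exists_subset_biUnion_pow hK
  refine ⟨m, fun g hg => ?_⟩
  obtain ⟨n, hn, hgn⟩ := hm g hg
  exact (wordDist_one_le hgn).trans hn

end IsCompactSymmGen

end WordMetric

/-! ### Comparison of the right-profiles -/

section Profiles

theorem isoRatio_mono {G : Type*} [MeasurableSpace G] (μ : Measure G) (p : ℝ≥0∞)
    (N : (G → ℝ) → ℝ≥0∞) {A B : Set G} (h : A ⊆ B) : isoRatio μ p N A ≤ isoRatio μ p N B :=
  iSup_mono fun _ => iSup_mono fun _ => iSup_mono' fun hf => ⟨hf.trans h, le_rfl⟩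

theorem le_isoRatio {G : Type*} [MeasurableSpace G] {μ : Measure G} {p : ℝ≥0∞}
    (N : (G → ℝ) → ℝ≥0∞) {A : Set G} {f : G → ℝ} (hf : MemLp f p μ)
    (hA : Function.support f ⊆ A) : eLpNorm f p μ / N f ≤ isoRatio μ p N A :=
  le_iSup_of_le f (le_iSup_of_le hf (le_iSup_of_le hA le_rfl))

theorem isoRatio_le {G : Type*} [MeasurableSpace G] {μ : Measure G} {p : ℝ≥0∞}
    {N : (G → ℝ) → ℝ≥0∞} {A : Set G} {L : ℝ≥0∞} (h : ∀ f : G → ℝ, MemLp f p μ →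
      Function.support f ⊆ A → eLpNorm f p μ / N f ≤ L) : isoRatio μ p N A ≤ L :=
  iSup_le fun f => iSup_le fun hf => iSup_le fun hA => h f hf hA

theorem compression_le {G : Type*} [Group G] (S : Set G) {H : Subgroup G} {T : Set H} {t : ℝ≥0∞} {h : H}
    (ht : t ≤ (wordDist T 1 h : ℝ≥0∞)) :
    compression S H T t ≤ (wordDist S 1 (h : G) : ℝ≥0∞) :=
  iInf_le_of_le 1 (iInf_le_of_le h (iInf_le_of_le ht (by simp)))

theorem rightTransNorm_le_rightGradNorm {G : Type*} [Group G] [MeasurableSpace G] (S : Set G)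
    (μ : Measure G) (p : ℝ≥0∞) (f : G → ℝ) :
    rightTransNorm S μ p f ≤ rightGradNorm S μ p f := by
  refine iSup₂_le fun s hs => eLpNorm_mono_enorm fun x => ?_
  rw [enorm_eq_self]
  exact le_iSup₂ (f := fun s _ => ‖f (x * s) - f x‖ₑ) s hs

variable {G : Type*} [Group G] [TopologicalSpace G] [IsTopologicalGroup G]
    [LocallyCompactSpace G] [T2Space G] [MeasurableSpace G] [BorelSpace G]

omit [LocallyCompactSpace G] in
/-- The profile of some ball is positive. -/
theorem exists_le_isoRatio_wordBall {S : Set G} (hS : IsCompactSymmGen S) (μ : Measure G)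
    [μ.IsHaarMeasure] (p : ℝ≥0∞) (hp : 1 ≤ p) {N : (G → ℝ) → ℝ≥0∞}
    (hN : ∀ f, N f ≤ rightGradNorm S μ p f) :
    ∃ n : ℕ, ∃ c : ℝ≥0, c ≠ 0 ∧ (c : ℝ≥0∞) ≤ isoRatio μ p N (wordBall S n) := by
  obtain ⟨n, hn⟩ : ∃ n : ℕ, μ (S ^ n) ≠ 0 := by
    by_contra! hall
    have h1 : μ (⋃ n : ℕ, S ^ n) = 0 := measure_iUnion_null hall
    rw [hS.iUnion_pow] at h1
    exact isOpen_univ.measure_ne_zero μ ⟨1, mem_univ _⟩ h1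
  have hp0 : p ≠ 0 := (zero_lt_one.trans_le hp).ne'
  set B := wordBall S (n : ℝ≥0∞)
  have hB : IsCompact B := hS.isCompact_wordBall n
  have hBμ : μ B ≠ 0 := fun h => hn (measure_mono_null (fun g hg => by
    have : wordDist S 1 g ≤ n := wordDist_one_le hg
    simpa [B, wordBall] using this) h)
  let f : G → ℝ := B.indicator fun _ => 1
  have hmem : ∀ K : Set G, IsCompact K → MemLp (K.indicator fun _ => (1 : ℝ)) p μ := fun K hK =>
    memLp_indicator_const p hK.measurableSet 1 (.inr hK.measure_lt_top.ne)
  have hf : MemLp f p μ := hmem B hB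
  have hf0 : eLpNorm f p μ ≠ 0 := by
    rw [Ne, eLpNorm_eq_zero_iff hf.1 hp0]
    intro h
    refine hBμ (measure_mono_null (fun g hg => ?_) (ae_iff.1 h))
    change ¬ f g = 0
    simp [f, hg]
  -- The gradient of the indicator of B is at most 1 and vanishes off this compact set.
  let B' := B ∪ B * S⁻¹
  have hB' : IsCompact B' := hB.union (hB.mul hS.isCompact.inv)
  have hgrad : N f ≠ ∞ := by
    refine ne_top_of_le_ne_top (hmem B' hB').2.ne ((hN f).trans ?_)
    refine eLpNorm_mono_enorm fun x => ?_
    rw [enorm_eq_self]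
    refine iSup₂_le fun s hs => ?_
    by_cases hx : x ∈ B'
    · rw [indicator_of_mem hx]
      by_cases h1 : x * s ∈ B <;> by_cases h2 : x ∈ B <;> simp [f, h1, h2]
    · have h1 : x ∉ B := fun h => hx (Or.inl h)
      have h2 : x * s ∉ B := fun h => hx (Or.inr (mem_mul.2
        ⟨x * s, h, s⁻¹, Set.inv_mem_inv.2 hs, by group⟩))
      simp [f, h1, h2]
  have hpos : 0 < eLpNorm f p μ / N f := ENNReal.div_pos hf0 hgrad
  obtain ⟨c, hc0, hc⟩ := ENNReal.lt_iff_exists_nnreal_btwn.1 hpos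
  exact ⟨n, c, by simpa using hc0.ne', hc.le.trans (le_isoRatio N hf support_indicator_subset)⟩

variable {H : Subgroup G} [LocallyCompactSpace H]

theorem rightGradNorm_comp_mul_left {H : Type*} [Group H] [TopologicalSpace H]
    [IsTopologicalGroup H] [MeasurableSpace H] [BorelSpace H] (T : Set H) (ν : Measure H)
    [ν.IsMulLeftInvariant] (p : ℝ≥0∞) (f : H → ℝ) (a : H) :
    rightGradNorm T ν p (fun h => f (a * h)) = rightGradNorm T ν p f := by
  have h := (measurableEmbedding_mulLeft a).eLpNorm_map_measure (μ := ν) (p := p)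
    (g := fun h => ⨆ t ∈ T, ‖f (h * t) - f h‖ₑ)
  rw [map_mul_left_eq_self] at h
  simp only [rightGradNorm, h]
  congr 1
  ext h
  simp [mul_assoc]

theorem eLpNorm_comp_mul_left {H : Type*} [Group H] [TopologicalSpace H]
    [IsTopologicalGroup H] [MeasurableSpace H] [BorelSpace H] (ν : Measure H)
    [ν.IsMulLeftInvariant] (p : ℝ≥0∞) (f : H → ℝ) (a : H) :
    eLpNorm (fun h => f (a * h)) p ν = eLpNorm f p ν := by
  have h := (measurableEmbedding_mulLeft a).eLpNorm_map_measure (μ := ν) (p := p) (g := f)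
  rw [map_mul_left_eq_self] at h
  exact h.symm

variable {μ : Measure G} [μ.IsHaarMeasure] [μ.Regular]
    {ν : Measure H} [ν.IsHaarMeasure] [ν.Regular]
    {S : Set G} {T : Set H} {p : ℝ≥0∞} {NG : (G → ℝ) → ℝ≥0∞} {NH : (H → ℝ) → ℝ≥0∞}

theorem isoProfile_asympLE (hS : IsCompactSymmGen S) (hH : IsClosed (H : Set G))
    (hT : IsCompactSymmGen T)
    (hmod : ∀ h : H, Measure.modularCharacterFun h = Measure.modularCharacterFun (h : G))
    (hp : 1 ≤ p) (hNG : ∀ f, rightTransNorm S μ p f ≤ NG f)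
    (hNH : ∀ f, NH f ≤ rightGradNorm T ν p f) :
    AsympLE (isoProfile μ p NG) (isoProfile ν p NH) := by
  obtain ⟨K, hK0, D, -, hK⟩ := exists_fiber_function (μ := μ) (ν := ν) hS hH hT hmod hp
  obtain ⟨n, c, hc0, hc⟩ := exists_le_isoRatio_wordBall hT ν p hp hNH
  have hBm := (hT.isCompact_wordBall n).measurableSet
  have hBt : ν (wordBall T n) ≠ ∞ := (hT.isCompact_wordBall n).measure_lt_top.ne
  have hle : ∀ {A : Set H} {v : ℝ≥0∞}, MeasurableSet A → ν A ≤ v →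
      isoRatio ν p NH A ≤ isoProfile ν p NH v := fun {A} v hA hv =>
    le_iSup_of_le A (le_iSup_of_le hA (le_iSup_of_le hv le_rfl))
  refine ⟨K, pos_iff_ne_zero.2 hK0, K + K / c, ?_⟩
  filter_upwards [eventually_ge_atTop ((ν (wordBall T n)).toNNReal / K)] with t ht
  -- For large t the profile of H is at least c, so the alternative ‖f‖ ≤ K N(f) costs only the
  -- extra constant K / c.
  have hct : (c : ℝ≥0∞) ≤ isoProfile ν p NH (K * t) := by
    refine hc.trans (hle hBm ?_)
    rw [← ENNReal.coe_toNNReal hBt]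
    rw [div_le_iff₀ (pos_iff_ne_zero.2 hK0), mul_comm] at ht
    exact_mod_cast ht
  refine iSup_le fun A => iSup_le fun hA => iSup_le fun hAt => isoRatio_le fun f hf hfA => ?_
  rw [ENNReal.coe_add, add_mul]
  rcases hK f hf with h | ⟨f', hf'm, hf', -, hsupp, hfr⟩
  · refine le_trans ?_ le_add_self
    calc eLpNorm f p μ / NG f ≤ K := ENNReal.div_le_of_le_mul (h.trans (by gcongr; exact hNG f))
      _ = ((K / c : ℝ≥0) : ℝ≥0∞) * c := by rw [← ENNReal.coe_mul, div_mul_cancel₀ _ hc0]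
      _ ≤ _ := by gcongr
  · refine le_trans ?_ le_self_add
    calc eLpNorm f p μ / NG f ≤ eLpNorm f p μ / rightTransNorm S μ p f :=
          ENNReal.div_le_div_left (hNG f) _
      _ ≤ K * (eLpNorm f' p ν / rightGradNorm T ν p f') := hfr
      _ ≤ K * (eLpNorm f' p ν / NH f') := by
          gcongr; exact hNH f'
      _ ≤ K * isoRatio ν p NH (Function.support f') := by
          gcongr; exact le_isoRatio NH hf' subset_rfl
      _ ≤ _ := by
          gcongr
          refine hle (measurableSet_support hf'm) ((hsupp A hfA).trans ?_)
          gcongr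

/-- The set B is left free so that the ball statements differ only in how they verify its two
conditions: the first absorbs the bounded alternative, the second contains the support of the fiber
function. -/
theorem exists_ballProfile_le (hS : IsCompactSymmGen S) (hH : IsClosed (H : Set G))
    (hT : IsCompactSymmGen T)
    (hmod : ∀ h : H, Measure.modularCharacterFun h = Measure.modularCharacterFun (h : G))
    (hp : 1 ≤ p) (hNG : ∀ f, rightTransNorm S μ p f ≤ NG f)
    (hNH : ∀ f, NH f ≤ rightGradNorm T ν p f) :
    ∃ (K : ℝ≥0) (k n : ℕ), ∀ (r : ℝ≥0∞) (B : Set H), wordBall T n ⊆ B →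
      (∀ h : H, (wordDist S 1 (h : G) : ℝ≥0∞) ≤ 2 * r + k → h ∈ B) →
      ballProfile S μ p NG r ≤ K * isoRatio ν p NH B := by
  obtain ⟨K, hK0, D, hD, hK⟩ := exists_fiber_function (μ := μ) (ν := ν) hS hH hT hmod hp
  obtain ⟨n, c, hc0, hc⟩ := exists_le_isoRatio_wordBall hT ν p hp hNH
  obtain ⟨m, hm⟩ := hS.exists_wordDist_le hD
  refine ⟨K + K / c, 2 * m, n, fun r B hnB hB => isoRatio_le fun f hf hfA => ?_⟩
  have hct : (c : ℝ≥0∞) ≤ isoRatio ν p NH B := hc.trans (isoRatio_mono ν p NH hnB)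
  rw [ENNReal.coe_add, add_mul]
  rcases hK f hf with h | ⟨f', hf'm, hf', ⟨x, hx⟩, -, hfr⟩
  · refine le_trans ?_ le_add_self
    calc eLpNorm f p μ / NG f ≤ K := ENNReal.div_le_of_le_mul (h.trans (by gcongr; exact hNG f))
      _ = ((K / c : ℝ≥0) : ℝ≥0∞) * c := by rw [← ENNReal.coe_mul, div_mul_cancel₀ _ hc0]
      _ ≤ _ := by gcongr
  · refine le_trans ?_ le_self_add
    -- The coset representative x is arbitrary. Left translation in H by a point a of the support
    -- removes it: h is expressed through two points of B(1, r) and two elements of D, whence length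
    -- at most 2r + 2m.
    obtain ⟨a, ha⟩ : ∃ a : H, ∀ h ∈ Function.support f', a ∈ Function.support f' := by
      rcases (Function.support f').eq_empty_or_nonempty with he | ⟨a, ha⟩
      · exact ⟨1, fun h hh => by simp [he] at hh⟩
      · exact ⟨a, fun _ _ => ha⟩
    have hsupp : Function.support (fun h => f' (a * h)) ⊆ B := fun h hh => by
      obtain ⟨u, hu, hxu⟩ := hx _ (ha (a * h) hh)
      obtain ⟨v, hv, hxv⟩ := hx (a * h) hh
      refine hB h ?_
      have h1 : (h : G) = u * ((x * a * u)⁻¹ * (x * (a * h : H) * v)) * v⁻¹ := by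
        push_cast; group
      have h2 : wordDist S 1 (h : G) ≤
          (m + (wordDist S 1 (x * a * u) + wordDist S 1 (x * (a * h : H) * v))) + m := by
        conv_lhs => rw [h1]
        refine (hS.wordDist_mul_le _ _).trans (add_le_add ((hS.wordDist_mul_le _ _).trans
          (add_le_add (hm u hu) ((hS.wordDist_mul_le _ _).trans
            (add_le_add (hS.wordDist_inv_le _) le_rfl)))) ?_)
        exact (hS.wordDist_inv_le v).trans (hm v hv)
      have h3 : (wordDist S 1 (x * a * u) : ℝ≥0∞) ≤ r := hfA hxu
      have h4 : (wordDist S 1 (x * (a * h : H) * v) : ℝ≥0∞) ≤ r := hfA hxv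
      calc (wordDist S 1 (h : G) : ℝ≥0∞) ≤ (m + ((wordDist S 1 (x * a * u) : ℝ≥0∞) +
            (wordDist S 1 (x * (a * h : H) * v) : ℝ≥0∞))) + m := by exact_mod_cast h2
        _ ≤ (m + (r + r)) + m := by gcongr
        _ = 2 * r + (2 * m : ℕ) := by push_cast; ring
    have hmem : MemLp (fun h => f' (a * h)) p ν :=
      ⟨(hf'm.comp (measurable_const_mul a)).aestronglyMeasurable, by
        rw [eLpNorm_comp_mul_left]; exact hf'.2⟩
    calc eLpNorm f p μ / NG f ≤ eLpNorm f p μ / rightTransNorm S μ p f :=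
          ENNReal.div_le_div_left (hNG f) _
      _ ≤ K * (eLpNorm f' p ν / rightGradNorm T ν p f') := hfr
      _ = K * (eLpNorm (fun h => f' (a * h)) p ν /
            rightGradNorm T ν p (fun h => f' (a * h))) := by
          rw [eLpNorm_comp_mul_left, rightGradNorm_comp_mul_left]
      _ ≤ K * (eLpNorm (fun h => f' (a * h)) p ν / NH (fun h => f' (a * h))) := by
          gcongr; exact hNH _
      _ ≤ _ := by
          gcongr; exact le_isoRatio NH hmem hsupp

/-- The comparison of the two right-profiles, for a pair of norms lying between the translation
norm and the gradient norm. -/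
theorem profiles_asympLE (hS : IsCompactSymmGen S) (hH : IsClosed (H : Set G))
    (hT : IsCompactSymmGen T)
    (hmod : ∀ h : H, Measure.modularCharacterFun h = Measure.modularCharacterFun (h : G))
    (hp : 1 ≤ p) (hNG : ∀ f, rightTransNorm S μ p f ≤ NG f)
    (hNH : ∀ f, NH f ≤ rightGradNorm T ν p f) :
    AsympLE (isoProfile μ p NG) (isoProfile ν p NH) ∧
      AsympLE (ballProfile S μ p NG) (ballProfile T ν p NH ∘ genInverse (compression S H T)) ∧
      (∃ c : ℝ≥0, 0 < c ∧
        AsympLE (fun t => ballProfile S μ p NG (c * compression S H T t))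
          (ballProfile T ν p NH)) ∧
      (Undistorted S H T → AsympLE (ballProfile S μ p NG) (ballProfile T ν p NH)) := by
  refine ⟨isoProfile_asympLE hS hH hT hmod hp hNG hNH, ?_⟩
  obtain ⟨K, k, n, hK⟩ := exists_ballProfile_le hS hH hT hmod hp hNG hNH
  -- The dilation 3 absorbs 2t + k for t ≥ k. The factor 1/4 turns 2r + k into ρ(t)/2 + k; if d_T(1,
  -- h) > t, then ρ(t) ≤ d_S(1, h), so d_S(1, h) ≤ 2k, which confines h to a compact set excluded
  -- for large t.
  refine ⟨⟨3, by norm_num, K, ?_⟩, ⟨1 / 4, by positivity, 1, one_pos, K, ?_⟩, ?_⟩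
  · obtain ⟨M, hM⟩ := hS.exists_wordDist_le
      ((hT.isCompact_wordBall n).image continuous_subtype_val)
    filter_upwards [eventually_ge_atTop (k : ℝ≥0), eventually_ge_atTop (M : ℝ≥0)] with t htk htM
    have hmem : ∀ h : H, (wordDist S 1 (h : G) : ℝ≥0∞) ≤ 3 * t →
        h ∈ wordBall T (genInverse (compression S H T) (3 * t)) := fun h hh => by
      have h1 : (wordDist T 1 h : ℝ≥0∞) ∈ {v | compression S H T v ≤ 3 * t} :=
        (compression_le S le_rfl).trans hh
      exact mem_wordBall.2 (le_sSup h1)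
    refine hK t _ (fun h hh => hmem h ?_) fun h hh => hmem h (hh.trans ?_)
    · have h1 : (wordDist S 1 (h : G) : ℝ≥0) ≤ t :=
        le_trans (by exact_mod_cast hM _ (mem_image_of_mem _ hh)) htM
      have h2 : (wordDist S 1 (h : G) : ℝ≥0) ≤ 3 * t :=
        h1.trans (le_mul_of_one_le_left zero_le (by norm_num))
      exact_mod_cast h2
    · have h1 : 2 * t + k ≤ 3 * t := by
        have : 3 * t = 2 * t + t := by ring
        rw [this]; gcongr
      exact_mod_cast h1
  · have hcpt : IsCompact {h : H | (h : G) ∈ wordBall S ((2 * k : ℕ) : ℝ≥0∞)} :=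
      hH.isClosedEmbedding_subtypeVal.isCompact_preimage (hS.isCompact_wordBall _)
    obtain ⟨M, hM⟩ := hT.exists_wordDist_le hcpt
    filter_upwards [eventually_ge_atTop (n : ℝ≥0), eventually_ge_atTop (M : ℝ≥0)] with t htn htM
    rw [ENNReal.coe_one, one_mul]
    refine hK _ _ (fun h hh => mem_wordBall.2 <| (mem_wordBall.1 hh).trans (by exact_mod_cast htn)) fun h hh => ?_
    by_contra hlt
    have hlt' : (t : ℝ≥0∞) < wordDist T 1 h := not_le.1 fun h => hlt (mem_wordBall.2 h)
    have hρ := compression_le S hlt'.le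
    have h1 : wordDist S 1 (h : G) ≤ 2 * k := by
      set d := wordDist S 1 (h : G)
      have h2 : (d : ℝ≥0∞) ≤ 2 * (((1 / 4 : ℝ≥0) : ℝ≥0∞) * d) + k := by
        refine hh.trans ?_
        gcongr
      have h3 : (d : ℝ≥0) ≤ 2 * (1 / 4 * d) + k := by exact_mod_cast h2
      have h4 : (d : ℝ) ≤ 2 * (1 / 4 * d) + k := by exact_mod_cast h3
      have h5 : (d : ℝ) ≤ 2 * k := by linarith
      exact_mod_cast h5
    have h2 : wordDist T 1 h ≤ M := hM h (mem_wordBall.2 (by exact_mod_cast h1))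
    have h3 : (wordDist T 1 h : ℝ≥0) ≤ t := le_trans (by exact_mod_cast h2) htM
    exact absurd hlt' (not_lt.2 (by exact_mod_cast h3))
  · rintro ⟨C, hC⟩
    refine ⟨2 * C + 1, by positivity, K, ?_⟩
    filter_upwards [eventually_ge_atTop (n : ℝ≥0), eventually_ge_atTop (C * k + C : ℝ≥0)]
      with t htn htk
    refine hK t _ (fun h hh => mem_wordBall.2 <| (mem_wordBall.1 hh).trans ?_) fun h hh => ?_
    · have h1 : (n : ℝ≥0) ≤ (2 * C + 1) * t :=
        htn.trans (le_mul_of_one_le_left zero_le (by simp))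
      exact_mod_cast h1
    · have h1 : (wordDist T 1 h : ℝ≥0∞) ≤ C * wordDist S 1 (h : G) + C := by
        exact_mod_cast hC 1 h
      refine mem_wordBall.2 ?_
      refine h1.trans ?_
      calc (C : ℝ≥0∞) * wordDist S 1 (h : G) + C ≤ C * (2 * t + k) + C := by gcongr
        _ ≤ _ := by
          have h2 : (C : ℝ≥0) * (2 * t + k) + C ≤ (2 * C + 1) * t := by
            calc (C : ℝ≥0) * (2 * t + k) + C = 2 * C * t + (C * k + C) := by ring
              _ ≤ 2 * C * t + t := by gcongr
              _ = _ := by ring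
          exact_mod_cast h2

end Profiles

/-! ### Left-profiles of unimodular groups -/

section Left

variable {G : Type*} [Group G] [TopologicalSpace G] [IsTopologicalGroup G] [MeasurableSpace G]
    [BorelSpace G] {μ : Measure G} [μ.IsInvInvariant] {S : Set G} {p : ℝ≥0∞}

theorem eLpNorm_comp_inv (f : G → ℝ) : eLpNorm (fun x => f x⁻¹) p μ = eLpNorm f p μ := by
  have h := (MeasurableEquiv.inv G).measurableEmbedding.eLpNorm_map_measure (μ := μ) (p := p)
    (g := f)
  have h2 : Measure.map (MeasurableEquiv.inv G) μ = μ := Measure.map_inv_eq_self μ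
  rw [h2] at h
  exact h.symm

theorem MeasureTheory.MemLp.comp_inv {f : G → ℝ} (hf : MemLp f p μ) :
    MemLp (fun x => f x⁻¹) p μ :=
  hf.comp_measurePreserving (Measure.measurePreserving_inv μ)

theorem rightTransNorm_comp_inv (f : G → ℝ) :
    rightTransNorm S μ p (fun x => f x⁻¹) = leftTransNorm S μ p f := by
  refine iSup_congr fun s => iSup_congr fun _ => ?_
  rw [← eLpNorm_comp_inv (fun x => f (s⁻¹ * x) - f x)]
  simp only [mul_inv_rev]

/-- The substitution x ↦ x⁻¹ preserves the measure and exchanges left with right translations.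
Volumes and word balls are unchanged, so the profiles themselves coincide. -/
theorem isoRatio_left_eq (A : Set G) :
    isoRatio μ p (leftTransNorm S μ p) A = isoRatio μ p (rightTransNorm S μ p) A⁻¹ := by
  refine le_antisymm (isoRatio_le fun f hf hA => ?_) (isoRatio_le fun f hf hA => ?_)
  · rw [← rightTransNorm_comp_inv, ← eLpNorm_comp_inv f]
    exact le_isoRatio _ hf.comp_inv fun x hx => Set.mem_inv.2 (hA hx)
  · have h1 : rightTransNorm S μ p f = leftTransNorm S μ p fun x => f x⁻¹ := by
      rw [← rightTransNorm_comp_inv]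
      simp only [inv_inv]
    rw [h1, ← eLpNorm_comp_inv f]
    exact le_isoRatio _ hf.comp_inv fun x hx => by simpa using hA hx

theorem isoProfile_left_eq :
    isoProfile μ p (leftTransNorm S μ p) = isoProfile μ p (rightTransNorm S μ p) := by
  ext v
  refine le_antisymm ?_ ?_ <;> refine iSup_le fun A => iSup_le fun hA => iSup_le fun hv => ?_
  · rw [isoRatio_left_eq]
    exact le_iSup_of_le A⁻¹ (le_iSup_of_le hA.inv (le_iSup_of_le
      (by rwa [Measure.measure_inv]) le_rfl))
  · rw [← inv_inv A, ← isoRatio_left_eq]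
    exact le_iSup_of_le A⁻¹ (le_iSup_of_le hA.inv (le_iSup_of_le
      (by rwa [Measure.measure_inv]) le_rfl))

theorem ballProfile_left_eq (hS : IsCompactSymmGen S) :
    ballProfile S μ p (leftTransNorm S μ p) = ballProfile S μ p (rightTransNorm S μ p) := by
  ext r
  rw [ballProfile, isoRatio_left_eq, hS.inv_wordBall]
  rfl

end Left

theorem mainTheorem3 {G : Type*} [Group G] [TopologicalSpace G] [IsTopologicalGroup G]
    [LocallyCompactSpace G] [T2Space G] [MeasurableSpace G] [BorelSpace G]
    (S : Set G) (hS : IsCompactSymmGen S)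
    (H : Subgroup G) (hH : IsClosed (H : Set G))
    (T : Set H) (hT : IsCompactSymmGen T)
    (μ : Measure G) [μ.IsHaarMeasure] [μ.Regular]
    (ν : Measure H) [ν.IsHaarMeasure] [ν.Regular]
    (hinv : CarriesInvariantMeasure H ∨ (μ.IsMulRightInvariant ∧ ν.IsMulRightInvariant))
    (p : ℝ≥0∞) (hp : 1 ≤ p) :
    -- the right-profiles, with the supremum over the generators inside the norm
    (AsympLE (isoProfile μ p (rightGradNorm S μ p)) (isoProfile ν p (rightGradNorm T ν p)) ∧
      AsympLE (ballProfile S μ p (rightGradNorm S μ p))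
        (ballProfile T ν p (rightGradNorm T ν p) ∘ genInverse (compression S H T)) ∧
      (∃ c : ℝ≥0, 0 < c ∧
        AsympLE (fun t => ballProfile S μ p (rightGradNorm S μ p) (c * compression S H T t))
          (ballProfile T ν p (rightGradNorm T ν p))) ∧
      (Undistorted S H T →
        AsympLE (ballProfile S μ p (rightGradNorm S μ p))
          (ballProfile T ν p (rightGradNorm T ν p)))) ∧
    -- the right-profiles, with the supremum over the generators outside the norm
    (AsympLE (isoProfile μ p (rightTransNorm S μ p)) (isoProfile ν p (rightTransNorm T ν p)) ∧
      AsympLE (ballProfile S μ p (rightTransNorm S μ p))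
        (ballProfile T ν p (rightTransNorm T ν p) ∘ genInverse (compression S H T)) ∧
      (∃ c : ℝ≥0, 0 < c ∧
        AsympLE (fun t => ballProfile S μ p (rightTransNorm S μ p) (c * compression S H T t))
          (ballProfile T ν p (rightTransNorm T ν p))) ∧
      (Undistorted S H T →
        AsympLE (ballProfile S μ p (rightTransNorm S μ p))
          (ballProfile T ν p (rightTransNorm T ν p)))) ∧
    -- the left-profiles, for unimodular groups
    (μ.IsMulRightInvariant → ν.IsMulRightInvariant →
      AsympLE (isoProfile μ p (leftTransNorm S μ p)) (isoProfile ν p (leftTransNorm T ν p)) ∧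
      (Undistorted S H T →
        AsympLE (ballProfile S μ p (leftTransNorm S μ p))
          (ballProfile T ν p (leftTransNorm T ν p)))) := by
  have : LocallyCompactSpace H := hH.isClosedEmbedding_subtypeVal.locallyCompactSpace
  have := hS.sigmaCompactSpace
  have hmod : ∀ h : H,
      Measure.modularCharacterFun h = Measure.modularCharacterFun (h : G) := fun h => by
    rcases hinv with hm | ⟨hμ, hν⟩
    · exact modularCharacterFun_eq_of_carriesInvariantMeasure ν μ hH hm h
    · rw [modularCharacterFun_eq_one ν, modularCharacterFun_eq_one μ]
  -- The two families of denominators are the two instances allowed by N ≥ translation norm on G and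
  -- N ≤ gradient norm on H.
  have hgrad := profiles_asympLE (μ := μ) (ν := ν) hS hH hT hmod hp
    (rightTransNorm_le_rightGradNorm S μ p) fun _ => le_rfl
  have htrans := profiles_asympLE (μ := μ) (ν := ν) hS hH hT hmod hp
    (fun _ => le_rfl) (rightTransNorm_le_rightGradNorm T ν p)
  refine ⟨hgrad, htrans, fun hμ hν => ?_⟩
  have := isInvInvariant_of_isMulRightInvariant μ
  have := isInvInvariant_of_isMulRightInvariant ν
  rw [isoProfile_left_eq, isoProfile_left_eq, ballProfile_left_eq hS, ballProfile_left_eq hT]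
  exact ⟨htrans.1, htrans.2.2.2⟩
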